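/- Let $n\in\mathbb N$ and $s\in(0,1)$ with $n>2s$, and write $2^*_s=\frac{2n}{n-2s}$. Let $K:\mathbb R^n\to(0,\infty)$ be measurable with - $K(x)=K(-x)$ for all $x$; - there is $\lambda>0$ with $\lambda\le K(x)|x|^{n+2s}$ for almost every $x$; - $\gamma K\in L^1(\mathbb R^n)$, where $\gamma(x)=\min\{|x|^2,1\}$. Assume - $(V_1)$ $V:\mathbb R^n\to\mathbb R$ is continuous and $\inf_{\mathbb R^n}V>0$; and that $f:\mathbb R\to\mathbb R$ is continuous and satisfies, with $F(t)=\int_0^t f(\tau)\,d\tau$, - $(f_1)$ $|f(t)|\le c_0|t|^{p-1}$ for all $t\in\mathbb R$, for some constant $c_0>0$ and some $p\in(2,2^*_s)$; - $(f_2)$ there is $\theta>2$ with $\theta F(t)\le t f(t)$ for all $t>0$; - $(f_3)$ $f(t)>0$ for all $t>0$ and $f(t)=0$ for all $t<0$. Let $E$ be the space of all $u\in L^2(\mathbb R^n)$ such that $(x,y)\mapsto (u(x)-u(y))\sqrt{K(x-y)}$ belongs to $L^2(\mathbb R^n\times\mathbb R^n)$ and $\int_{\mathbb R^n}V u^2\,dx<\infty$,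 with the norm $$\|u\|=\left(\int_{\mathbb R^n}\int_{\mathbb R^n}(u(x)-u(y))^2K(x-y)\,dx\,dy+\int_{\mathbb R^n}V(x)u^2\,dx\right)^{1/2}.$$ Put $k=\frac{2\theta}{\theta-2}$, let $R>0$, and define $$\tilde f(x,t)=\begin{cases} f(t) & \text{if } kf(t)\le V(x)t,\\ \frac{V(x)}{k}t & \text{if } kf(t)>V(x)t,\end{cases}\qquad g(x,t)=\begin{cases} f(t) & \text{if } |x|\le R,\\ \tilde f(x,t) & \text{if } |x|>R,\end{cases}$$ $G(x,t)=\int_0^t g(x,\tau)\,d\tau$, and $$J(u)=\tfrac12\|u\|^2-\int_{\mathbb R^n}G(x,u(x))\,dx,\qquad u\in E.$$ Then $J$ is well defined (that is, $G(\cdot,u)\in L^1(\mathbb R^n)$ for every $u\in E$) and of class $C^1$ on $E$, and it satisfies the Palais–Smale condition: every sequence $(u_m)$ in $E$ such that $(J(u_m))$ is bounded and $J'(u_m)\to0$ in the dual space of $E$ has a subsequence that converges in the norm of $E$. -/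

import Mathlib

open MeasureTheory Filter Topology

noncomputable section

namespace NonlocalSchrodinger

/-- Admissible kernels of order `s` on `ℝⁿ`: positive and (Lebesgue) measurable, even,
bounded below by a multiple of `|x|^{-(n+2s)}`, with `min {|x|², 1} K` integrable. -/
structure IsKernel {n : ℕ} (s : ℝ) (K : EuclideanSpace ℝ (Fin n) → ℝ) : Prop where
  pos : ∀ x, 0 < K x
  aemeasurable : AEMeasurable K volume
  even : ∀ x, K x = K (-x)
  lower : ∃ c : ℝ, 0 < c ∧
    ∀ᵐ x ∂(volume : Measure (EuclideanSpace ℝ (Fin n))), c ≤ K x * ‖x‖ ^ ((n : ℝ) + 2 * s)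
  integrable : Integrable (fun x => min (‖x‖ ^ 2) 1 * K x) volume

/-- Admissible potentials: continuous with positive infimum. -/
structure IsPotential {n : ℕ} (V : EuclideanSpace ℝ (Fin n) → ℝ) : Prop where
  continuous : Continuous V
  lower : ∃ V₀ : ℝ, 0 < V₀ ∧ ∀ x, V₀ ≤ V x

/-- The primitive `∫₀ᵗ h` of a function of one real variable. -/
def primitive (h : ℝ → ℝ) (t : ℝ) : ℝ := ∫ τ in (0 : ℝ)..t, h τ

/-- Admissible nonlinearities, with growth exponent `p` and superquadraticity exponent `θ`. -/
structure IsNonlinearity (p θ : ℝ) (f : ℝ → ℝ) : Prop where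
  continuous : Continuous f
  growth : ∃ c₀ : ℝ, 0 < c₀ ∧ ∀ t, |f t| ≤ c₀ * |t| ^ (p - 1)
  superquadratic : ∀ t, 0 < t → θ * primitive f t ≤ t * f t
  pos : ∀ t, 0 < t → 0 < f t
  zero : ∀ t, t < 0 → f t = 0

variable {n : ℕ} {s : ℝ} {K V : EuclideanSpace ℝ (Fin n) → ℝ}

/-- The difference quotient map `(x, y) ↦ (u x - u y) √K(x - y)`. -/
def diffK (K u : EuclideanSpace ℝ (Fin n) → ℝ)
    (z : EuclideanSpace ℝ (Fin n) × EuclideanSpace ℝ (Fin n)) : ℝ :=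
  (u z.1 - u z.2) * √(K (z.1 - z.2))

theorem diffK_congr (K : EuclideanSpace ℝ (Fin n) → ℝ) {u v : EuclideanSpace ℝ (Fin n) → ℝ}
    (h : u =ᵐ[volume] v) : diffK K u =ᵐ[volume] diffK K v := by
  have h1 := (Measure.quasiMeasurePreserving_fst (μ := volume) (ν := volume)
    (α := EuclideanSpace ℝ (Fin n)) (β := EuclideanSpace ℝ (Fin n))).ae_eq_comp h
  have h2 := (Measure.quasiMeasurePreserving_snd (μ := volume) (ν := volume)
    (α := EuclideanSpace ℝ (Fin n)) (β := EuclideanSpace ℝ (Fin n))).ae_eq_comp h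
  filter_upwards [h1, h2] with z hz1 hz2
  simp only [Function.comp] at hz1 hz2
  simp [diffK, hz1, hz2]

theorem diffK_add (K u v : EuclideanSpace ℝ (Fin n) → ℝ) :
    diffK K (u + v) = diffK K u + diffK K v := by
  funext z; simp only [diffK, Pi.add_apply]; ring

theorem diffK_smul (K u : EuclideanSpace ℝ (Fin n) → ℝ) (c : ℝ) :
    diffK K (c • u) = c • diffK K u := by
  funext z; simp only [diffK, Pi.smul_apply, smul_eq_mul]; ring

theorem integrable_potential_iff (hV : IsPotential V)
    (u : Lp ℝ 2 (volume : Measure (EuclideanSpace ℝ (Fin n)))) :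
    Integrable (fun x => V x * u x ^ 2) volume ↔ MemLp (fun x => √(V x) * u x) 2 volume := by
  obtain ⟨V₀, h0, hV0⟩ := hV.lower
  have hm : AEStronglyMeasurable (fun x => √(V x) * u x) volume :=
    (Real.continuous_sqrt.comp hV.continuous).aestronglyMeasurable.mul
      (Lp.aestronglyMeasurable u)
  rw [memLp_two_iff_integrable_sq hm]
  refine integrable_congr (Eventually.of_forall fun x => ?_)
  simp only [mul_pow, Real.sq_sqrt (h0.le.trans (hV0 x))]

/-- The space `E` as a linear subspace of `L²(ℝⁿ)`: those `u ∈ L²` for which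
`(u x - u y) √K(x - y)` is in `L²(ℝⁿ × ℝⁿ)` and `∫ V u² < ∞`. -/
def energySubmodule (_hK : IsKernel s K) (hV : IsPotential V) :
    Submodule ℝ (Lp ℝ 2 (volume : Measure (EuclideanSpace ℝ (Fin n)))) where
  carrier := {u | MemLp (diffK K u) 2 volume ∧ Integrable (fun x => V x * u x ^ 2) volume}
  zero_mem' := by
    refine ⟨?_, ?_⟩
    · refine (memLp_congr_ae (diffK_congr K (Lp.coeFn_zero ℝ 2 volume))).2 ?_
      have : diffK K (0 : EuclideanSpace ℝ (Fin n) → ℝ) = 0 := by funext z; simp [diffK]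
      rw [this]; exact MemLp.zero
    · refine (integrable_congr ?_).2 (integrable_zero _ ℝ volume)
      filter_upwards [Lp.coeFn_zero ℝ 2 (volume : Measure (EuclideanSpace ℝ (Fin n)))] with x hx
      rw [hx]; simp
  add_mem' := by
    rintro u v ⟨hu1, hu2⟩ ⟨hv1, hv2⟩
    refine ⟨?_, ?_⟩
    · refine (memLp_congr_ae (diffK_congr K (Lp.coeFn_add u v))).2 ?_
      rw [diffK_add]; exact hu1.add hv1
    · rw [integrable_potential_iff hV] at hu2 hv2 ⊢
      refine (memLp_congr_ae ?_).2 (hu2.add hv2)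
      filter_upwards [Lp.coeFn_add u v] with x hx
      simp only [hx, Pi.add_apply]; ring
  smul_mem' := by
    rintro c u ⟨hu1, hu2⟩
    refine ⟨?_, ?_⟩
    · refine (memLp_congr_ae (diffK_congr K (Lp.coeFn_smul c u))).2 ?_
      rw [diffK_smul]; exact hu1.const_smul c
    · rw [integrable_potential_iff hV] at hu2 ⊢
      refine (memLp_congr_ae ?_).2 (hu2.const_smul c)
      filter_upwards [Lp.coeFn_smul c u] with x hx
      simp only [hx, Pi.smul_apply, smul_eq_mul]; ring

/-- The space `E`, carrying its own (energy) norm rather than the norm of `L²`. -/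
def EnergySpace (hK : IsKernel s K) (hV : IsPotential V) : Type :=
  ↥(energySubmodule hK hV)

namespace EnergySpace

variable {hK : IsKernel s K} {hV : IsPotential V}

instance : AddCommGroup (EnergySpace hK hV) :=
  inferInstanceAs (AddCommGroup ↥(energySubmodule hK hV))

instance : Module ℝ (EnergySpace hK hV) :=
  inferInstanceAs (Module ℝ ↥(energySubmodule hK hV))

/-- The underlying element of `L²(ℝⁿ)`. -/
def toL2 (u : EnergySpace hK hV) : Lp ℝ 2 (volume : Measure (EuclideanSpace ℝ (Fin n))) :=
  u.1

instance : CoeFun (EnergySpace hK hV) (fun _ => EuclideanSpace ℝ (Fin n) → ℝ) :=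
  ⟨fun u => u.toL2⟩

theorem coe_add (u v : EnergySpace hK hV) :
    ⇑(u + v).toL2 =ᵐ[volume] ⇑u.toL2 + ⇑v.toL2 := Lp.coeFn_add u.1 v.1

theorem coe_smul (c : ℝ) (u : EnergySpace hK hV) :
    ⇑(c • u).toL2 =ᵐ[volume] c • ⇑u.toL2 := Lp.coeFn_smul c u.1

/-- The bilinear form `[u, v] = ∬ (u x - u y) (v x - v y) K(x - y) dx dy`. -/
def gagliardo (u v : EnergySpace hK hV) : ℝ :=
  ∫ z : EuclideanSpace ℝ (Fin n) × EuclideanSpace ℝ (Fin n),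
    (u z.1 - u z.2) * (v z.1 - v z.2) * K (z.1 - z.2)

/-- The bilinear form `∫ V u v`. -/
def potentialForm (u v : EnergySpace hK hV) : ℝ := ∫ x, V x * u x * v x

theorem gagliardo_eq (u v : EnergySpace hK hV) :
    gagliardo u v = ∫ z, diffK K u z * diffK K v z := by
  refine integral_congr_ae (Eventually.of_forall fun z => ?_)
  have := Real.mul_self_sqrt (hK.pos (z.1 - z.2)).le
  simp only [diffK]
  linear_combination -(u z.1 - u z.2) * (v z.1 - v z.2) * this

theorem potentialForm_eq (u v : EnergySpace hK hV) :
    potentialForm u v = ∫ x, (√(V x) * u x) * (√(V x) * v x) := by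
  obtain ⟨V₀, h0, hV0⟩ := hV.lower
  refine integral_congr_ae (Eventually.of_forall fun x => ?_)
  have := Real.mul_self_sqrt (h0.le.trans (hV0 x))
  linear_combination -(u x) * (v x) * this

theorem memLp_diffK (u : EnergySpace hK hV) : MemLp (diffK K u) 2 volume := u.2.1

theorem memLp_potential (u : EnergySpace hK hV) :
    MemLp (fun x => √(V x) * u x) 2 volume := (integrable_potential_iff hV u.1).1 u.2.2

theorem gagliardo_add_left (u v w : EnergySpace hK hV) :
    gagliardo (u + v) w = gagliardo u w + gagliardo v w := by
  simp only [gagliardo_eq]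
  refine Eq.trans (integral_congr_ae ?_)
    (integral_add (u.memLp_diffK.integrable_mul w.memLp_diffK)
      (v.memLp_diffK.integrable_mul w.memLp_diffK))
  filter_upwards [diffK_congr K (coe_add u v)] with z hz
  rw [hz, diffK_add]; simp only [Pi.add_apply]; ring

theorem gagliardo_smul_left (c : ℝ) (u v : EnergySpace hK hV) :
    gagliardo (c • u) v = c * gagliardo u v := by
  simp only [gagliardo_eq]
  rw [← integral_const_mul]
  refine integral_congr_ae ?_
  filter_upwards [diffK_congr K (coe_smul c u)] with z hz
  rw [hz, diffK_smul]; simp only [Pi.smul_apply, smul_eq_mul]; ring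

theorem potentialForm_add_left (u v w : EnergySpace hK hV) :
    potentialForm (u + v) w = potentialForm u w + potentialForm v w := by
  simp only [potentialForm_eq]
  refine Eq.trans (integral_congr_ae ?_)
    (integral_add (u.memLp_potential.integrable_mul w.memLp_potential)
      (v.memLp_potential.integrable_mul w.memLp_potential))
  filter_upwards [coe_add u v] with z hz
  rw [hz]; simp only [Pi.add_apply]; ring

theorem potentialForm_smul_left (c : ℝ) (u v : EnergySpace hK hV) :
    potentialForm (c • u) v = c * potentialForm u v := by
  simp only [potentialForm_eq]
  rw [← integral_const_mul]
  refine integral_congr_ae ?_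
  filter_upwards [coe_smul c u] with z hz
  rw [hz]; simp only [Pi.smul_apply, smul_eq_mul]; ring

theorem gagliardo_self_nonneg (u : EnergySpace hK hV) : 0 ≤ gagliardo u u := by
  rw [gagliardo_eq]; exact integral_nonneg fun z => mul_self_nonneg _

theorem potentialForm_self_nonneg (u : EnergySpace hK hV) : 0 ≤ potentialForm u u := by
  rw [potentialForm_eq]; exact integral_nonneg fun z => mul_self_nonneg _

theorem eq_zero_of_potentialForm (u : EnergySpace hK hV) (h : potentialForm u u = 0) :
    u = 0 := by
  obtain ⟨V₀, h0, hV0⟩ := hV.lower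
  rw [potentialForm_eq, integral_eq_zero_iff_of_nonneg (fun x => mul_self_nonneg _)
    (u.memLp_potential.integrable_mul u.memLp_potential)] at h
  refine Subtype.ext ((Lp.eq_zero_iff_ae_eq_zero).2 ?_)
  filter_upwards [h] with x hx
  have h1 : √(V x) * u x = 0 := mul_self_eq_zero.1 hx
  exact (mul_eq_zero.1 h1).resolve_left (Real.sqrt_pos.2 (h0.trans_le (hV0 x))).ne'

/-- The inner product `⟨u, v⟩ = [u, v] + ∫ V u v` on `E`. -/
abbrev core (hK : IsKernel s K) (hV : IsPotential V) :
    InnerProductSpace.Core ℝ (EnergySpace hK hV) where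
  inner u v := gagliardo u v + potentialForm u v
  conj_inner_symm u v := by
    simp only [gagliardo, potentialForm, conj_trivial]
    congr 2 <;> funext z <;> ring
  re_inner_nonneg u :=
    add_nonneg (gagliardo_self_nonneg u) (potentialForm_self_nonneg u)
  add_left u v w := by
    simp only [gagliardo_add_left, potentialForm_add_left]; ring
  smul_left u v c := by
    simp only [gagliardo_smul_left, potentialForm_smul_left, conj_trivial]; ring
  definite u h := eq_zero_of_potentialForm u (by
    have h1 := gagliardo_self_nonneg u
    have h2 := potentialForm_self_nonneg u
    linarith)

/-- The energy norm `‖u‖ = ([u, u] + ∫ V u²)^{1/2}` on `E`. -/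
instance : NormedAddCommGroup (EnergySpace hK hV) :=
  (core hK hV).toNormedAddCommGroup

instance : InnerProductSpace ℝ (EnergySpace hK hV) :=
  InnerProductSpace.ofCore (core hK hV).toCore

theorem norm_sq_eq (u : EnergySpace hK hV) :
    ‖u‖ ^ 2 = (∫ z : EuclideanSpace ℝ (Fin n) × EuclideanSpace ℝ (Fin n),
      (u z.1 - u z.2) ^ 2 * K (z.1 - z.2)) + ∫ x, V x * u x ^ 2 := by
  rw [← real_inner_self_eq_norm_sq]
  change gagliardo u u + potentialForm u u = _
  simp only [gagliardo, potentialForm, sq, mul_assoc]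

end EnergySpace

/-- The truncation `f̃(x, t)`, written in terms of the value `v = V x`, with
`k = 2θ / (θ - 2)`. -/
def truncated (θ : ℝ) (f : ℝ → ℝ) (v t : ℝ) : ℝ :=
  open Classical in
  if 2 * θ / (θ - 2) * f t ≤ v * t then f t else v / (2 * θ / (θ - 2)) * t

/-- The penalized nonlinearity `g(x, t)`: `f(t)` for `|x| ≤ R`, and `f̃(x, t)` for `|x| > R`. -/
def penalized (θ R : ℝ) (f : ℝ → ℝ) (V : EuclideanSpace ℝ (Fin n) → ℝ)
    (x : EuclideanSpace ℝ (Fin n)) (t : ℝ) : ℝ :=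
  open Classical in
  if ‖x‖ ≤ R then f t else truncated θ f (V x) t

/-- The functional `J(u) = ‖u‖² / 2 - ∫ G(x, u) dx`, where `G(x, ·)` is the primitive
of `g(x, ·)`. -/
def penalizedEnergy (θ R : ℝ) (f : ℝ → ℝ) (hK : IsKernel s K) (hV : IsPotential V)
    (u : EnergySpace hK hV) : ℝ :=
  1 / 2 * ‖u‖ ^ 2 - ∫ x, primitive (penalized θ R f V x) (u x)

/-- The Palais–Smale condition for a functional on a normed space: every sequence along which
`J` is bounded and `J'` tends to `0` in the dual norm has a norm-convergent subsequence. -/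
def PalaisSmale {H : Type*} [NormedAddCommGroup H] [NormedSpace ℝ H] (J : H → ℝ) : Prop :=
  ∀ u : ℕ → H, (∃ C : ℝ, ∀ m, |J (u m)| ≤ C) →
    Tendsto (fun m => fderiv ℝ J (u m)) atTop (𝓝 0) →
    ∃ w : H, ∃ φ : ℕ → ℕ, StrictMono φ ∧ Tendsto (u ∘ φ) atTop (𝓝 w)

end NonlocalSchrodinger

end

/-! The kernel enters through its lower bound: the integral of |u(x) - u(y)|² over the ball B_r(x)
is at most C r^{n+2s} D(x), where D(x) = ∫ (u(x) - u(y))² K(x - y) dy. Bounding |u(x)|² by this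
oscillation plus an average over B_r(x) has two uses. Hölder's inequality for the average and an
optimal r give a pointwise bound of |u(x)|^{2*} that is linear in D(x); integrating it yields the
Sobolev inequality `IsKernel.exists_lintegral_rpow_le`, so E lies in L^r for 2 ≤ r ≤ 2*. Taking r
small instead gives local compactness: a bounded weakly null sequence has a subsequence tending to 0
almost everywhere (`exists_subseq_ae_tendsto_zero`).

For the C¹ property, V may be unbounded, so g has no power bound uniform in x. By `penalized_eq_add`
it is a function of growth |t|^{p-1} plus √V h(x, √V t) with |h(x, τ)| ≤ |τ|/k. Hence ∫ G is a
power-growth functional on L^p composed with the inclusion, plus one on L² composed with u ↦ √V u.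
Each is C¹ because superposition operators are continuous from L^p to the dual exponent.

For Palais–Smale, k is such that J(u) - J'(u)u/θ ≥ (θ-2)/(4θ) ‖u‖², which bounds the sequence. Take
a weak limit w along a subsequence with z_m = u_m - w → 0 almost everywhere. Testing J'(u_m) with
z_m gives ‖z_m‖² = ∫ g(x, z_m + w) z_m + o(1). The integrand is at most V z_m²/k plus terms whose
integrals vanish: |z_m|^p on the ball of radius R, where p < 2* gives compactness, and products of
powers of the fixed w with z_m. Since 1/k ≤ 1/2, the norm absorbs the quadratic term and z_m → 0 in
E; no estimate of the tails of z_m is needed. -/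

noncomputable section

namespace NonlocalSchrodinger

/-! ### Superposition operators on L^p -/

section Nemytskii

open scoped ENNReal

variable {X : Type*} [MeasurableSpace X] {μ : Measure X}

/-- Dominated convergence with a dominating function perturbed by E → 0 in L¹: the truncated
difference F - E is dominated by the fixed B, and F ≤ (F - E) + E. -/
theorem tendsto_lintegral_zero_of_le_add {F E : ℕ → X → ℝ≥0∞} {B : X → ℝ≥0∞}
    (hF : ∀ m, AEMeasurable (F m) μ) (hE : ∀ m, AEMeasurable (E m) μ)
    (hle : ∀ m, ∀ᵐ x ∂μ, F m x ≤ E m x + B x) (hB : ∫⁻ x, B x ∂μ ≠ ∞)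
    (hE0 : Tendsto (fun m => ∫⁻ x, E m x ∂μ) atTop (𝓝 0))
    (hF0 : ∀ᵐ x ∂μ, Tendsto (fun m => F m x) atTop (𝓝 0)) :
    Tendsto (fun m => ∫⁻ x, F m x ∂μ) atTop (𝓝 0) := by
  have h1 : Tendsto (fun m => ∫⁻ x, (F m x - E m x) ∂μ) atTop (𝓝 (∫⁻ _, 0 ∂μ)) := by
    refine tendsto_lintegral_of_dominated_convergence' B (fun m => (hF m).sub (hE m))
      (fun m => ?_) hB ?_
    · filter_upwards [hle m] with x hx
      exact tsub_le_iff_left.2 hx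
    · filter_upwards [hF0] with x hx
      exact tendsto_of_tendsto_of_tendsto_of_le_of_le tendsto_const_nhds hx
        (fun m => zero_le) (fun m => tsub_le_self)
  rw [lintegral_zero] at h1
  have h2 := h1.add hE0
  rw [add_zero] at h2
  refine tendsto_of_tendsto_of_tendsto_of_le_of_le tendsto_const_nhds h2
    (fun m => zero_le) (fun m => ?_)
  change ∫⁻ x, F m x ∂μ ≤ ∫⁻ x, (F m x - E m x) ∂μ + ∫⁻ x, E m x ∂μ
  rw [← lintegral_add_right' _ (hE m)]
  exact lintegral_mono fun x => le_tsub_add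

/-- Functions `h(x, t)`, measurable and continuous in `t`, with `|h(x, t)| ≤ c |t|^{p-1}`. -/
structure IsPowerCaratheodory (p : ℝ) (h : X → ℝ → ℝ) : Prop where
  measurable : Measurable fun z : X × ℝ => h z.1 z.2
  continuous : ∀ x, Continuous (h x)
  growth : ∃ c : ℝ, 0 ≤ c ∧ ∀ x t, |h x t| ≤ c * |t| ^ (p - 1)

theorem hasDerivAt_primitive {g : ℝ → ℝ} (hg : Continuous g) (t : ℝ) :
    HasDerivAt (primitive g) (g t) t :=
  intervalIntegral.integral_hasDerivAt_right (hg.intervalIntegrable _ _)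
    (hg.stronglyMeasurableAtFilter _ _) hg.continuousAt

theorem continuous_primitive {g : ℝ → ℝ} (hg : Continuous g) : Continuous (primitive g) :=
  continuous_iff_continuousAt.2 fun t => (hasDerivAt_primitive hg t).continuousAt

namespace IsPowerCaratheodory

variable {p q : ℝ} {h : X → ℝ → ℝ}

theorem measurable_primitive (hh : IsPowerCaratheodory p h) :
    Measurable fun z : X × ℝ => primitive (h z.1) z.2 := by
  have h1 : Measurable (Function.uncurry fun (t : ℝ) (x : X) => primitive (h x) t) := by
    refine measurable_uncurry_of_continuous_of_measurable
      (fun x => continuous_primitive (hh.continuous x)) (fun t => ?_)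
    have h2 : StronglyMeasurable (Function.uncurry h) := hh.measurable.stronglyMeasurable
    exact (h2.integral_prod_right.sub h2.integral_prod_right).measurable
  exact h1.comp measurable_swap

theorem abs_primitive_le (hp : 1 < p) {g : ℝ → ℝ} {c : ℝ} (hc : 0 ≤ c)
    (hg : ∀ t, |g t| ≤ c * |t| ^ (p - 1)) (t : ℝ) : |primitive g t| ≤ c * |t| ^ p := by
  have h1 : ‖∫ τ in (0 : ℝ)..t, g τ‖ ≤ c * |t| ^ (p - 1) * |t - 0| := by
    refine intervalIntegral.norm_integral_le_of_norm_le_const fun τ hτ => (hg τ).trans ?_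
    have : |τ| ≤ |t| := by
      rcases Set.mem_uIoc.1 hτ with h | h
      · rw [abs_of_pos h.1, abs_of_pos (h.1.trans_le h.2)]; exact h.2
      · rw [abs_of_nonpos h.2, abs_of_neg (h.1.trans_le h.2)]; linarith [h.1]
    gcongr
  rw [sub_zero, mul_assoc] at h1
  refine h1.trans_eq ?_
  rcases eq_or_ne t 0 with rfl | ht
  · simp [Real.zero_rpow (by linarith : p ≠ 0)]
  · rw [← Real.rpow_add_one (abs_pos.2 ht).ne']; simp

theorem aestronglyMeasurable (hh : IsPowerCaratheodory p h) {u : X → ℝ}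
    (hu : AEStronglyMeasurable u μ) : AEStronglyMeasurable (fun x => h x (u x)) μ :=
  (hh.measurable.comp_aemeasurable
    (aemeasurable_id.prodMk hu.aemeasurable)).aestronglyMeasurable

theorem aestronglyMeasurable_primitive (hh : IsPowerCaratheodory p h) {u : X → ℝ}
    (hu : AEStronglyMeasurable u μ) :
    AEStronglyMeasurable (fun x => primitive (h x) (u x)) μ :=
  (hh.measurable_primitive.comp_aemeasurable
    (aemeasurable_id.prodMk hu.aemeasurable)).aestronglyMeasurable

theorem integrable_abs_rpow (hp : 1 < p) {u : X → ℝ} (hu : MemLp u (ENNReal.ofReal p) μ) :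
    Integrable (fun x => |u x| ^ p) μ := by
  have := hu.integrable_norm_rpow (by simp; linarith) ENNReal.ofReal_ne_top
  rwa [ENNReal.toReal_ofReal (by linarith)] at this

theorem integrable_primitive (hh : IsPowerCaratheodory p h) (hp : 1 < p) {u : X → ℝ}
    (hu : MemLp u (ENNReal.ofReal p) μ) : Integrable (fun x => primitive (h x) (u x)) μ := by
  obtain ⟨c, hc, hg⟩ := hh.growth
  exact ((integrable_abs_rpow hp hu).const_mul c).mono'
    (hh.aestronglyMeasurable_primitive hu.1)
    (Eventually.of_forall fun x => abs_primitive_le hp hc (hg x) (u x))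

theorem memLp (hh : IsPowerCaratheodory p h) (hpq : p.HolderConjugate q) {u : X → ℝ}
    (hu : MemLp u (ENNReal.ofReal p) μ) :
    MemLp (fun x => h x (u x)) (ENNReal.ofReal q) μ := by
  obtain ⟨c, hc, hg⟩ := hh.growth
  have hp := hpq.lt
  have h1 := hu.norm_rpow_div (ENNReal.ofReal (p - 1))
  rw [← ENNReal.ofReal_div_of_pos (by linarith), ENNReal.toReal_ofReal (by linarith),
    ← hpq.conjugate_eq] at h1
  refine MemLp.of_le_mul (c := c) h1 (hh.aestronglyMeasurable hu.1)
    (Eventually.of_forall fun x => ?_)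
  rw [Real.norm_of_nonneg (by positivity : 0 ≤ ‖u x‖ ^ (p - 1))]
  exact hg x (u x)

/-- The exponents match because (p - 1) q = p. Using |a - b| and |b| on the right separates a part
that vanishes as a → b in L^p from a fixed integrable part. -/
theorem abs_sub_rpow_le (hpq : p.HolderConjugate q) {g : ℝ → ℝ} {c : ℝ} (hc : 0 ≤ c)
    (hg : ∀ t, |g t| ≤ c * |t| ^ (p - 1)) (a b : ℝ) :
    |g a - g b| ^ q ≤ (2 * c) ^ q * (|a - b| + |b|) ^ p := by
  have hp := hpq.lt
  have h1 : |g a - g b| ≤ 2 * c * (|a - b| + |b|) ^ (p - 1) := by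
    have ha : |a| ≤ |a - b| + |b| := by simpa using abs_add_le (a - b) b
    have hb : |b| ≤ |a - b| + |b| := by linarith [abs_nonneg (a - b)]
    calc |g a - g b| ≤ |g a| + |g b| := abs_sub _ _
      _ ≤ c * (|a - b| + |b|) ^ (p - 1) + c * (|a - b| + |b|) ^ (p - 1) := by
        refine add_le_add ((hg a).trans ?_) ((hg b).trans ?_) <;> gcongr
      _ = _ := by ring
  calc |g a - g b| ^ q ≤ (2 * c * (|a - b| + |b|) ^ (p - 1)) ^ q :=
        Real.rpow_le_rpow (abs_nonneg _) h1 hpq.symm.nonneg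
    _ = _ := by
      rw [Real.mul_rpow (by positivity) (by positivity), ← Real.rpow_mul (by positivity),
        hpq.sub_one_mul_conj]

variable [Fact (1 ≤ ENNReal.ofReal p)] [Fact (1 ≤ ENNReal.ofReal q)]

/-- The superposition operator `u ↦ h(·, u)` from `L^p` to `L^q`, `1/p + 1/q = 1`. -/
def nemytskii (hh : IsPowerCaratheodory p h) (hpq : p.HolderConjugate q)
    (u : Lp ℝ (ENNReal.ofReal p) μ) : Lp ℝ (ENNReal.ofReal q) μ :=
  (hh.memLp hpq (Lp.memLp u)).toLp _

/-- Every subsequence has a further one converging almost everywhere. Along it |h(x, v) - h(x, u)|^q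
tends to 0 pointwise and is at most C|v - u|^p + C|u|^p, the situation of
`tendsto_lintegral_zero_of_le_add`. -/
theorem continuous_nemytskii (hh : IsPowerCaratheodory p h) (hpq : p.HolderConjugate q) :
    Continuous (hh.nemytskii hpq (μ := μ)) := by
  obtain ⟨c, hc, hg⟩ := hh.growth
  have hp := hpq.lt
  have hq := hpq.symm.lt
  rw [continuous_iff_seqContinuous]
  intro v u hvu
  refine tendsto_of_subseq_tendsto fun ns hns => ?_
  have hv := hvu.comp hns
  obtain ⟨φ, hφ, hae⟩ := (tendstoInMeasure_of_tendsto_Lp hv).exists_seq_tendsto_ae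
  refine ⟨φ, ?_⟩
  have hv' := hv.comp hφ.tendsto_atTop
  rw [Lp.tendsto_Lp_iff_tendsto_eLpNorm'] at hv'
  set w : ℕ → Lp ℝ (ENNReal.ofReal p) μ := fun m => v (ns (φ m)) with hw
  have hp0 : ENNReal.ofReal p ≠ 0 := by simp; linarith
  have hq0 : ENNReal.ofReal q ≠ 0 := by simp; linarith
  have e1 : (ENNReal.ofReal p).toReal = p := ENNReal.toReal_ofReal (by linarith)
  have e2 : (ENNReal.ofReal q).toReal = q := ENNReal.toReal_ofReal (by linarith)
  change Tendsto (fun m => hh.nemytskii hpq (w m)) atTop (𝓝 (hh.nemytskii hpq u))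
  unfold nemytskii
  rw [Lp.tendsto_Lp_iff_tendsto_eLpNorm'']
  simp only [eLpNorm_eq_lintegral_rpow_enorm_toReal hq0 ENNReal.ofReal_ne_top, e2]
  have hE : Tendsto (fun m => ∫⁻ x, ‖w m x - u x‖ₑ ^ p ∂μ) atTop (𝓝 0) := by
    have := (ENNReal.continuous_rpow_const (y := p)).tendsto 0 |>.comp hv'
    rw [ENNReal.zero_rpow_of_pos (by linarith)] at this
    refine this.congr fun m => ?_
    simp only [Function.comp, eLpNorm_eq_lintegral_rpow_enorm_toReal hp0 ENNReal.ofReal_ne_top, e1]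
    rw [← ENNReal.rpow_mul, one_div_mul_cancel (by linarith), ENNReal.rpow_one]
    rfl
  set C : ℝ≥0∞ := ENNReal.ofReal ((2 * c) ^ q) * 2 ^ (p - 1) with hC
  have hCt : C ≠ ∞ := ENNReal.mul_ne_top ENNReal.ofReal_ne_top
    (ENNReal.rpow_ne_top_of_nonneg (by linarith) (by simp))
  have key : Tendsto (fun m => ∫⁻ x, ‖h x (w m x) - h x (u x)‖ₑ ^ q ∂μ) atTop (𝓝 0) := by
    refine tendsto_lintegral_zero_of_le_add (E := fun m x => C * ‖w m x - u x‖ₑ ^ p)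
      (B := fun x => C * ‖u x‖ₑ ^ p) (fun m => ?_) (fun m => ?_) (fun m => ?_) ?_ ?_ ?_
    · exact ((hh.aestronglyMeasurable (Lp.aestronglyMeasurable _)).sub
        (hh.aestronglyMeasurable (Lp.aestronglyMeasurable _))).enorm.pow_const _
    · exact (((Lp.aestronglyMeasurable _).sub
        (Lp.aestronglyMeasurable _)).enorm.pow_const _).const_mul _
    · refine Eventually.of_forall fun x => ?_
      have h1 := ENNReal.ofReal_le_ofReal (abs_sub_rpow_le hpq hc (hg x) (w m x) (u x))
      rw [ENNReal.ofReal_mul (by positivity),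
        ← ENNReal.ofReal_rpow_of_nonneg (abs_nonneg _) (by linarith),
        ← ENNReal.ofReal_rpow_of_nonneg
          (add_nonneg (abs_nonneg (w m x - u x)) (abs_nonneg (u x))) (by linarith),
        ENNReal.ofReal_add (abs_nonneg _) (abs_nonneg _)] at h1
      simp only [← Real.enorm_eq_ofReal_abs] at h1
      refine h1.trans ?_
      rw [← mul_add, hC, mul_assoc]
      gcongr
      exact ENNReal.rpow_add_le_mul_rpow_add_rpow _ _ hp.le
    · rw [lintegral_const_mul' _ _ hCt]
      refine ENNReal.mul_ne_top hCt ?_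
      have := lintegral_rpow_enorm_lt_top_of_eLpNorm_lt_top hp0 ENNReal.ofReal_ne_top
        (Lp.memLp u).2
      rw [e1] at this
      exact this.ne
    · simp_rw [lintegral_const_mul' _ _ hCt]
      simpa using ENNReal.Tendsto.const_mul hE (Or.inr hCt)
    · filter_upwards [hae] with x hx
      have h1 : Tendsto (fun m => h x (w m x) - h x (u x)) atTop (𝓝 0) := by
        simpa using (((hh.continuous x).tendsto (u x)).comp hx).sub_const (h x (u x))
      have h2 := (ENNReal.continuous_rpow_const (y := q)).tendsto 0 |>.comp
        ((continuous_enorm.tendsto (0 : ℝ)).comp h1 |>.trans (by simp))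
      rwa [ENNReal.zero_rpow_of_pos (by linarith)] at h2
  have := (ENNReal.continuous_rpow_const (y := 1 / q)).tendsto 0 |>.comp key
  rw [ENNReal.zero_rpow_of_pos (by positivity)] at this
  exact this

end IsPowerCaratheodory
end Nemytskii

/-! ### Differentiability of integral functionals -/

section DifferentiableFunctional

open scoped ENNReal

/-- A Gâteaux differentiable functional whose derivative is continuous is Fréchet differentiable. -/
theorem hasFDerivAt_of_hasDerivAt_line {E : Type*} [NormedAddCommGroup E] [NormedSpace ℝ E]
    {Ψ : E → ℝ} {A : E → E →L[ℝ] ℝ} (hA : Continuous A)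
    (h : ∀ u v : E, ∀ t : ℝ, HasDerivAt (fun t : ℝ => Ψ (u + t • v)) (A (u + t • v) v) t) (u : E) :
    HasFDerivAt Ψ (A u) u := by
  rw [hasFDerivAt_iff_isLittleO_nhds_zero, Asymptotics.isLittleO_iff]
  intro ε hε
  obtain ⟨δ, hδ, hAδ⟩ := Metric.continuousAt_iff.1 hA.continuousAt ε hε
  filter_upwards [Metric.ball_mem_nhds (0 : E) hδ] with v hv
  have hv' : ‖v‖ < δ := by simpa using hv
  -- Mean value inequality on [0, 1] for t ↦ Ψ(u + t v) - t A(u) v, whose derivative is at most ε‖v‖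
  -- since A varies by at most ε on the δ-ball around u.
  have := norm_image_sub_le_of_norm_deriv_le_segment_01'
    (f := fun t : ℝ => Ψ (u + t • v) - t * A u v)
    (f' := fun t : ℝ => A (u + t • v) v - A u v) (C := ε * ‖v‖)
    (fun t _ => by
      have h1 := (h u v t).sub ((hasDerivAt_id t).mul_const (A u v))
      rw [one_mul] at h1
      exact h1.hasDerivWithinAt)
    (fun t ht => by
      rw [← sub_apply]
      refine (ContinuousLinearMap.le_opNorm _ _).trans ?_
      gcongr
      refine (hAδ (x := u + t • v) ?_).le.trans' (by rw [dist_eq_norm])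
      rw [dist_eq_norm, add_sub_cancel_left, norm_smul, Real.norm_of_nonneg ht.1]
      nlinarith [ht.1, ht.2, norm_nonneg v])
  simpa [sub_right_comm] using this

variable {X : Type*} [MeasurableSpace X] {μ : Measure X}

namespace IsPowerCaratheodory

variable {p q : ℝ} {h : X → ℝ → ℝ}
  [Fact (1 ≤ ENNReal.ofReal p)] [Fact (1 ≤ ENNReal.ofReal q)]

/-- The functional `v ↦ ∫ h(x, u) v dx` on `L^p`. -/
def derivFunctional (hh : IsPowerCaratheodory p h) (hpq : p.HolderConjugate q)
    (u : Lp ℝ (ENNReal.ofReal p) μ) : Lp ℝ (ENNReal.ofReal p) μ →L[ℝ] ℝ :=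
  haveI := hpq.symm.ennrealOfReal
  ContinuousLinearMap.lpPairing μ (ENNReal.ofReal q) (ENNReal.ofReal p)
    (ContinuousLinearMap.mul ℝ ℝ) (hh.nemytskii hpq u)

theorem derivFunctional_apply (hh : IsPowerCaratheodory p h) (hpq : p.HolderConjugate q)
    (u v : Lp ℝ (ENNReal.ofReal p) μ) :
    hh.derivFunctional hpq u v = ∫ x, h x (u x) * v x ∂μ := by
  unfold derivFunctional
  rw [ContinuousLinearMap.lpPairing_eq_integral]
  refine integral_congr_ae ?_
  filter_upwards [(hh.memLp hpq (Lp.memLp u)).coeFn_toLp] with x hx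
  simp only [nemytskii, hx, ContinuousLinearMap.mul_apply']

theorem continuous_derivFunctional (hh : IsPowerCaratheodory p h) (hpq : p.HolderConjugate q) :
    Continuous (hh.derivFunctional hpq (μ := μ)) := by
  have := hpq.symm.ennrealOfReal
  exact (ContinuousLinearMap.lpPairing μ (ENNReal.ofReal q) (ENNReal.ofReal p)
    (ContinuousLinearMap.mul ℝ ℝ)).continuous.comp (hh.continuous_nemytskii hpq)

theorem hasDerivAt_integral_primitive (hh : IsPowerCaratheodory p h) (hpq : p.HolderConjugate q)
    (u v : Lp ℝ (ENNReal.ofReal p) μ) (t₀ : ℝ) :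
    HasDerivAt (fun t : ℝ => ∫ x, primitive (h x) ((u + t • v : Lp ℝ _ μ) x) ∂μ)
      (hh.derivFunctional hpq (u + t₀ • v) v) t₀ := by
  obtain ⟨c, hc, hg⟩ := hh.growth
  have hp := hpq.lt
  have hcoe : ∀ t : ℝ, ∀ᵐ x ∂μ, (u + t • v : Lp ℝ _ μ) x = u x + t * v x := fun t => by
    filter_upwards [Lp.coeFn_add u (t • v), Lp.coeFn_smul t v] with x h1 h2
    rw [h1, Pi.add_apply, h2, Pi.smul_apply, smul_eq_mul]
  have e1 : (fun t : ℝ => ∫ x, primitive (h x) ((u + t • v : Lp ℝ _ μ) x) ∂μ) =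
      fun t : ℝ => ∫ x, primitive (h x) (u x + t * v x) ∂μ := by
    funext t
    refine integral_congr_ae ?_
    filter_upwards [hcoe t] with x hx
    rw [hx]
  have e2 : hh.derivFunctional hpq (u + t₀ • v) v = ∫ x, h x (u x + t₀ * v x) * v x ∂μ := by
    rw [derivFunctional_apply]
    refine integral_congr_ae ?_
    filter_upwards [hcoe t₀] with x hx
    rw [hx]
  rw [e1, e2]
  have hm : ∀ t : ℝ, MemLp (fun x => u x + t * v x) (ENNReal.ofReal p) μ := fun t =>
    (Lp.memLp u).add ((Lp.memLp v).const_mul t)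
  -- For |t - t₀| < 1 this one function bounds both |u + t v| and |v|, so c times its p-th power
  -- dominates the derivative in t.
  have hb : MemLp (fun x => ‖u x‖ + (|t₀| + 1) * ‖v x‖) (ENNReal.ofReal p) μ :=
    (Lp.memLp u).norm.add ((Lp.memLp v).norm.const_mul _)
  refine (hasDerivAt_integral_of_dominated_loc_of_deriv_le
    (F := fun t x => primitive (h x) (u x + t * v x))
    (F' := fun t x => h x (u x + t * v x) * v x)
    (bound := fun x => c * |‖u x‖ + (|t₀| + 1) * ‖v x‖| ^ p)
    (Metric.ball_mem_nhds t₀ one_pos)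
    (Eventually.of_forall fun t => hh.aestronglyMeasurable_primitive (hm t).1)
    (hh.integrable_primitive hp (hm t₀))
    ((hh.aestronglyMeasurable (hm t₀).1).mul (Lp.aestronglyMeasurable v))
    (Eventually.of_forall fun x t ht => ?_)
    ((integrable_abs_rpow hp hb).const_mul c)
    (Eventually.of_forall fun x t _ => ?_)).2
  · have ht' : |t| ≤ |t₀| + 1 := by
      have h1 : |t - t₀| < 1 := ht
      have h2 : |t| - |t₀| ≤ |t - t₀| := abs_sub_abs_le_abs_sub t t₀
      linarith
    set M := ‖u x‖ + (|t₀| + 1) * ‖v x‖ with hM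
    have hM0 : 0 ≤ M := by positivity
    have h1 : |u x + t * v x| ≤ M := by
      refine (abs_add_le _ _).trans ?_
      rw [abs_mul, hM]
      simp only [Real.norm_eq_abs]
      gcongr
    have h2 : |v x| ≤ M := by
      rw [hM]; simp only [Real.norm_eq_abs]
      nlinarith [abs_nonneg (u x), abs_nonneg (v x), abs_nonneg t₀,
        mul_nonneg (abs_nonneg t₀) (abs_nonneg (v x))]
    rw [abs_of_nonneg hM0, norm_mul, Real.norm_eq_abs, Real.norm_eq_abs]
    calc |h x (u x + t * v x)| * |v x| ≤ c * |u x + t * v x| ^ (p - 1) * M := by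
          gcongr; exact hg x _
      _ ≤ c * M ^ (p - 1) * M := by gcongr
      _ = c * M ^ p := by
        rcases hM0.eq_or_lt with h0 | h0
        · rw [← h0, mul_zero, Real.zero_rpow (by linarith), mul_zero]
        · rw [mul_assoc, ← Real.rpow_add_one h0.ne', sub_add_cancel]
  · have h1 : HasDerivAt (fun t : ℝ => u x + t * v x) (v x) t := by
      simpa using ((hasDerivAt_id t).mul_const (v x)).const_add (u x)
    exact (hasDerivAt_primitive (hh.continuous x) _).comp t h1

theorem hasFDerivAt_integral_primitive (hh : IsPowerCaratheodory p h)
    (hpq : p.HolderConjugate q) (u : Lp ℝ (ENNReal.ofReal p) μ) :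
    HasFDerivAt (fun u : Lp ℝ (ENNReal.ofReal p) μ => ∫ x, primitive (h x) (u x) ∂μ)
      (hh.derivFunctional hpq u) u :=
  hasFDerivAt_of_hasDerivAt_line (hh.continuous_derivFunctional hpq)
    (fun u v t => hh.hasDerivAt_integral_primitive hpq u v t) u

end IsPowerCaratheodory
end DifferentiableFunctional

/-! ### The fractional Sobolev inequality -/

section Sobolev

open scoped ENNReal

variable {n : ℕ} {s : ℝ} {K : EuclideanSpace ℝ (Fin n) → ℝ}

theorem enorm_sq_eq_ofReal (a : ℝ) : ‖a‖ₑ ^ 2 = ENNReal.ofReal (a ^ 2) := by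
  rw [Real.enorm_eq_ofReal_abs, ← ENNReal.ofReal_pow (abs_nonneg _), sq_abs]

theorem enorm_diffK_sq (hK : IsKernel s K) (u : EuclideanSpace ℝ (Fin n) → ℝ)
    (x y : EuclideanSpace ℝ (Fin n)) :
    ‖diffK K u (x, y)‖ₑ ^ 2 = ENNReal.ofReal ((u x - u y) ^ 2 * K (x - y)) := by
  rw [enorm_sq_eq_ofReal, diffK, mul_pow,
    Real.sq_sqrt (hK.pos _).le]

/-- For |x - y| ≤ r the lower bound on K gives 1 ≤ c⁻¹ K(x - y) r^{n+2s} for almost every y; insert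
this factor under the integral. -/
theorem IsKernel.exists_lintegral_ball_sub_le (hK : IsKernel s K) (hs : 0 < s) :
    ∃ C : ℝ, 0 < C ∧ ∀ (u : EuclideanSpace ℝ (Fin n) → ℝ) (x : EuclideanSpace ℝ (Fin n)) (r : ℝ),
      0 < r → ∫⁻ y in Metric.ball x r, ‖u x - u y‖ₑ ^ 2 ≤
        ENNReal.ofReal (C * r ^ ((n : ℝ) + 2 * s)) * ∫⁻ y, ‖diffK K u (x, y)‖ₑ ^ 2 := by
  obtain ⟨c, hc, hlow⟩ := hK.lower
  refine ⟨c⁻¹, inv_pos.2 hc, fun u x r hr => ?_⟩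
  have h1 : ∀ᵐ y ∂(volume : Measure (EuclideanSpace ℝ (Fin n))),
      c ≤ K (x - y) * ‖x - y‖ ^ ((n : ℝ) + 2 * s) :=
    (Measure.measurePreserving_sub_left volume x).quasiMeasurePreserving.ae hlow
  rw [← lintegral_const_mul' _ _ ENNReal.ofReal_ne_top]
  refine le_trans (lintegral_mono_ae ?_) (setLIntegral_le_lintegral (Metric.ball x r) _)
  filter_upwards [ae_restrict_of_ae h1, ae_restrict_mem Metric.isOpen_ball.measurableSet]
    with y hy hyr
  rw [enorm_diffK_sq hK, ← ENNReal.ofReal_mul (by positivity), enorm_sq_eq_ofReal]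
  refine ENNReal.ofReal_le_ofReal ?_
  have hd : ‖x - y‖ ≤ r := by
    rw [← dist_eq_norm, dist_comm]; exact (Metric.mem_ball.1 hyr).le
  have h2 : c ≤ K (x - y) * r ^ ((n : ℝ) + 2 * s) := by
    refine hy.trans ?_
    have := (hK.pos (x - y)).le
    gcongr
  have h3 : 1 ≤ c⁻¹ * (K (x - y) * r ^ ((n : ℝ) + 2 * s)) := by
    rw [inv_mul_eq_div, one_le_div hc]; exact h2
  calc (u x - u y) ^ 2 ≤ (u x - u y) ^ 2 * (c⁻¹ * (K (x - y) * r ^ ((n : ℝ) + 2 * s))) :=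
        le_mul_of_one_le_right (sq_nonneg _) h3
    _ = _ := by ring

theorem enorm_sq_le_two_mul (a b : ℝ) : ‖a‖ₑ ^ 2 ≤ 2 * ‖a - b‖ₑ ^ 2 + 2 * ‖b‖ₑ ^ 2 := by
  have h : a ^ 2 ≤ 2 * (a - b) ^ 2 + 2 * b ^ 2 := by nlinarith [sq_nonneg (a - 2 * b)]
  have h' := ENNReal.ofReal_le_ofReal h
  rw [ENNReal.ofReal_add (by positivity) (by positivity), ENNReal.ofReal_mul (by norm_num),
    ENNReal.ofReal_mul (by norm_num)] at h'
  simpa [enorm_sq_eq_ofReal] using h'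

theorem enorm_sq_mul_measure_le {X : Type*} [MeasurableSpace X] {μ : Measure X} {v : X → ℝ}
    (hv : AEMeasurable v μ) (a : ℝ) (B : Set X) :
    ‖a‖ₑ ^ 2 * μ B ≤ 2 * (∫⁻ y in B, ‖a - v y‖ₑ ^ 2 ∂μ) + 2 * ∫⁻ y in B, ‖v y‖ₑ ^ 2 ∂μ := by
  rw [← setLIntegral_const, ← lintegral_const_mul' _ _ (by simp),
    ← lintegral_const_mul' _ _ (by simp),
    ← lintegral_add_right' _ ((hv.restrict.enorm.pow_const _).const_mul _)]
  exact lintegral_mono fun y => enorm_sq_le_two_mul a (v y)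

/-- The choice r^n = M/d makes the two terms on the right equal to the geometric mean. -/
theorem le_geom_mean_of_forall_rpow {n s a d M C : ℝ} (hs : 0 < s) (hn : 2 * s < n)
    (hd : 0 ≤ d) (hM : 0 ≤ M) (hC : 0 ≤ C)
    (h : ∀ r : ℝ, 0 < r → a ≤ C * (r ^ (2 * s) * d + r ^ (2 * s - n) * M)) :
    a ≤ 2 * C * (M ^ (2 * s / n) * d ^ (1 - 2 * s / n)) := by
  have hn0 : 0 < n := by linarith
  have hβ : 2 * s / n < 1 := (div_lt_one hn0).2 hn
  have hβ0 : 0 < 2 * s / n := by positivity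
  -- M or d may vanish, and then the optimal r is not available; both are raised by ε, which tends
  -- to 0 at the end.
  have key : ∀ ε : ℝ, 0 < ε →
      a ≤ 2 * C * ((M + ε) ^ (2 * s / n) * (d + ε) ^ (1 - 2 * s / n)) := by
    intro ε hε
    have hM' : 0 < M + ε := by linarith
    have hd' : 0 < d + ε := by linarith
    set r := ((M + ε) / (d + ε)) ^ (1 / n) with hr
    have hr0 : 0 < r := by positivity
    have e1 : r ^ (2 * s) * (d + ε) = (M + ε) ^ (2 * s / n) * (d + ε) ^ (1 - 2 * s / n) := by
      rw [hr, ← Real.rpow_mul (by positivity), Real.div_rpow hM'.le hd'.le, Real.rpow_sub hd',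
        Real.rpow_one, show 1 / n * (2 * s) = 2 * s / n by ring]
      ring
    have e2 : r ^ (2 * s - n) * (M + ε) =
        (M + ε) ^ (2 * s / n) * (d + ε) ^ (1 - 2 * s / n) := by
      rw [hr, ← Real.rpow_mul (by positivity), Real.div_rpow hM'.le hd'.le,
        show 1 / n * (2 * s - n) = 2 * s / n - 1 by field_simp, Real.rpow_sub hM', Real.rpow_one,
        show 1 - 2 * s / n = -(2 * s / n - 1) by ring, Real.rpow_neg hd'.le]
      field_simp
    calc a ≤ C * (r ^ (2 * s) * d + r ^ (2 * s - n) * M) := h r hr0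
      _ ≤ C * (r ^ (2 * s) * (d + ε) + r ^ (2 * s - n) * (M + ε)) := by gcongr <;> linarith
      _ = _ := by rw [e1, e2]; ring
  have hcont : ContinuousAt (fun ε : ℝ =>
      2 * C * ((M + ε) ^ (2 * s / n) * (d + ε) ^ (1 - 2 * s / n))) 0 := by
    refine continuousAt_const.mul (ContinuousAt.mul ?_ ?_)
    · exact (continuousAt_const.add continuousAt_id).rpow_const (Or.inr hβ0.le)
    · exact (continuousAt_const.add continuousAt_id).rpow_const (Or.inr (by linarith))
  have ht := (hcont.tendsto.mono_left (nhdsWithin_le_nhds (s := Set.Ioi 0)))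
  simp only [add_zero] at ht
  exact ge_of_tendsto ht (eventually_mem_nhdsWithin.mono fun ε hε => key ε hε)

theorem volume_ball_eq_mul (x : EuclideanSpace ℝ (Fin n)) {r : ℝ} (hr : 0 < r) :
    volume (Metric.ball x r) =
      ENNReal.ofReal (r ^ (n : ℝ)) * volume (Metric.ball (0 : EuclideanSpace ℝ (Fin n)) 1) := by
  rw [Measure.addHaar_ball_of_pos _ _ hr, finrank_euclideanSpace_fin, Real.rpow_natCast]

/-- Hölder against the constant 1 on B, with conjugate exponents n/(n-2s) and n/(2s). -/
theorem lintegral_sq_ball_le (hs : 0 < s) (hn : 2 * s < (n : ℝ))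
    {v : EuclideanSpace ℝ (Fin n) → ℝ} (hv : AEMeasurable v)
    (B : Set (EuclideanSpace ℝ (Fin n))) :
    ∫⁻ y in B, ‖v y‖ₑ ^ 2 ≤
      (∫⁻ y, ‖v y‖ₑ ^ (2 * (n : ℝ) / ((n : ℝ) - 2 * s))) ^ (1 - 2 * s / (n : ℝ)) *
        volume B ^ (2 * s / (n : ℝ)) := by
  have hn0 : (0 : ℝ) < n := by linarith
  have h2 : (0 : ℝ) < n - 2 * s := by linarith
  have hconj : ((n : ℝ) / (n - 2 * s)).HolderConjugate ((n : ℝ) / (2 * s)) := by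
    rw [Real.holderConjugate_iff]
    constructor
    · rw [one_lt_div h2]; linarith
    · field_simp; ring
  have h := ENNReal.lintegral_mul_le_Lp_mul_Lq (volume.restrict B) hconj
    (f := fun y => ‖v y‖ₑ ^ 2) (g := fun _ => 1) (hv.restrict.enorm.pow_const _)
    aemeasurable_const
  simp only [Pi.mul_apply, mul_one, ENNReal.one_rpow, lintegral_const, Measure.restrict_apply
    MeasurableSet.univ, Set.univ_inter, one_mul, one_div_div] at h
  refine h.trans ?_
  rw [sub_div, div_self hn0.ne']
  gcongr ?_ ^ _ * _
  · rw [sub_nonneg, div_le_one hn0]; exact hn.le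
  refine (lintegral_mono fun y => ?_).trans (setLIntegral_le_lintegral _ _)
  rw [← ENNReal.rpow_natCast, ← ENNReal.rpow_mul]
  refine (congrArg _ ?_).le
  push_cast; ring

end Sobolev

section Sobolev

open scoped ENNReal

variable {n : ℕ} {s : ℝ} {K : EuclideanSpace ℝ (Fin n) → ℝ}

/-- On B_r(x) the oscillation of v costs r^{2s} D(x), and the mean of v² is at most a multiple of
r^{2s-n} I^{1-2s/n}, with I the critical integral of v. Optimizing r leaves a bound linear in D(x),
hence integrable in x. The function v stands for a truncation of |u|: its own critical integral is
finite, while its oscillation is controlled by that of u. -/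
theorem IsKernel.exists_enorm_rpow_le (hK : IsKernel s K) (hs : 0 < s) (hn : 2 * s < (n : ℝ)) :
    ∃ C : ℝ, 0 < C ∧ ∀ u v : EuclideanSpace ℝ (Fin n) → ℝ, AEMeasurable v →
      (∀ x y, |v x - v y| ≤ |u x - u y|) →
      ∫⁻ y, ‖v y‖ₑ ^ (2 * (n : ℝ) / ((n : ℝ) - 2 * s)) ≠ ∞ →
      ∀ x, ∫⁻ y, ‖diffK K u (x, y)‖ₑ ^ 2 ≠ ∞ →
      ‖v x‖ₑ ^ (2 * (n : ℝ) / ((n : ℝ) - 2 * s)) ≤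
        ENNReal.ofReal C *
          (∫⁻ y, ‖v y‖ₑ ^ (2 * (n : ℝ) / ((n : ℝ) - 2 * s))) ^ (2 * s / (n : ℝ)) *
          ∫⁻ y, ‖diffK K u (x, y)‖ₑ ^ 2 := by
  have hn0 : (0 : ℝ) < n := by linarith
  have h2 : (0 : ℝ) < n - 2 * s := by linarith
  have hβ : 2 * s / (n : ℝ) < 1 := (div_lt_one hn0).2 hn
  have hβ0 : 0 < 2 * s / (n : ℝ) := by positivity
  obtain ⟨C₁, hC₁, hball⟩ := hK.exists_lintegral_ball_sub_le hs
  set ω := (volume (Metric.ball (0 : EuclideanSpace ℝ (Fin n)) 1)).toReal with hω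
  have hωt : volume (Metric.ball (0 : EuclideanSpace ℝ (Fin n)) 1) = ENNReal.ofReal ω :=
    (ENNReal.ofReal_toReal measure_ball_lt_top.ne).symm
  have hω0 : 0 < ω :=
    ENNReal.toReal_pos (Metric.measure_ball_pos _ _ one_pos).ne' measure_ball_lt_top.ne
  set C₂ : ℝ := 2 * C₁ / ω + 2 * ω ^ (2 * s / (n : ℝ)) / ω with hC₂
  refine ⟨(2 * C₂) ^ ((n : ℝ) / (n - 2 * s)), by positivity, fun u v hv huv hI x hD => ?_⟩
  set I := ∫⁻ y, ‖v y‖ₑ ^ (2 * (n : ℝ) / ((n : ℝ) - 2 * s)) with hIdef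
  set D := ∫⁻ y, ‖diffK K u (x, y)‖ₑ ^ 2 with hDdef
  set M := I.toReal ^ (1 - 2 * s / (n : ℝ)) with hM
  have hIt : I = ENNReal.ofReal I.toReal := (ENNReal.ofReal_toReal hI).symm
  have hDt : D = ENNReal.ofReal D.toReal := (ENNReal.ofReal_toReal hD).symm
  have hM0 : 0 ≤ M := by positivity
  have key : |v x| ^ 2 ≤ 2 * C₂ * (M ^ (2 * s / (n : ℝ)) * D.toReal ^ (1 - 2 * s / (n : ℝ))) := by
    refine le_geom_mean_of_forall_rpow hs hn ENNReal.toReal_nonneg hM0 (by positivity)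
      fun r hr => ?_
    have h3 := enorm_sq_mul_measure_le hv (v x) (Metric.ball x r)
    have h4 : ∫⁻ y in Metric.ball x r, ‖v x - v y‖ₑ ^ 2 ≤
        ENNReal.ofReal (C₁ * r ^ ((n : ℝ) + 2 * s)) * D := by
      refine (lintegral_mono fun y => ?_).trans (hball u x r hr)
      gcongr
      simp only [Real.enorm_eq_ofReal_abs]
      exact ENNReal.ofReal_le_ofReal (huv x y)
    have h5 := lintegral_sq_ball_le hs hn hv (Metric.ball x r)
    have h6 := h3.trans (add_le_add (mul_le_mul_right h4 2) (mul_le_mul_right h5 2))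
    rw [← hIdef, volume_ball_eq_mul x hr, hωt, hIt, hDt, enorm_sq_eq_ofReal,
      ENNReal.ofReal_rpow_of_nonneg ENNReal.toReal_nonneg (by linarith),
      ← ENNReal.ofReal_mul (by positivity), ← ENNReal.ofReal_mul (by positivity),
      ENNReal.ofReal_rpow_of_nonneg (by positivity) hβ0.le,
      ← ENNReal.ofReal_mul (by positivity), ← ENNReal.ofReal_mul (by positivity),
      show (2 : ℝ≥0∞) = ENNReal.ofReal 2 by simp, ← ENNReal.ofReal_mul (by positivity),
      ← ENNReal.ofReal_mul (by positivity), ← ENNReal.ofReal_add (by positivity) (by positivity),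
      ENNReal.ofReal_le_ofReal_iff (by positivity), ← hM,
      Real.mul_rpow (by positivity) hω0.le, ← Real.rpow_mul hr.le,
      mul_div_cancel₀ _ hn0.ne'] at h6
    have hrn : 0 < r ^ (n : ℝ) := by positivity
    rw [sq_abs, Real.rpow_sub hr]
    rw [Real.rpow_add hr] at h6
    have h7 : v x ^ 2 ≤ 2 * C₁ / ω * (r ^ (2 * s) * D.toReal) +
        2 * ω ^ (2 * s / (n : ℝ)) / ω * (r ^ (2 * s) / r ^ (n : ℝ) * M) := by
      rw [← le_div_iff₀ (by positivity)] at h6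
      refine h6.trans_eq ?_
      field_simp
    refine h7.trans ?_
    rw [hC₂]
    have p1 : 0 ≤ 2 * C₁ / ω * (r ^ (2 * s) / r ^ (n : ℝ) * M) := by positivity
    have p2 : 0 ≤ 2 * ω ^ (2 * s / (n : ℝ)) / ω * (r ^ (2 * s) * D.toReal) := by positivity
    linarith
  -- The power n/(n-2s) turns the exponent 1 - 2s/n of D into 1 and the exponent 2 of |v x| into 2*;
  -- as M = I^{1-2s/n}, I receives the exponent 2s/n.
  have hpow := Real.rpow_le_rpow (by positivity) key
    (by positivity : 0 ≤ (n : ℝ) / (n - 2 * s))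
  rw [Real.mul_rpow (x := 2 * C₂) (by positivity) (by positivity),
    Real.mul_rpow (x := M ^ (2 * s / (n : ℝ))) (by positivity) (by positivity), hM, ← Real.rpow_mul (by positivity), ← Real.rpow_mul (by positivity),
    ← Real.rpow_mul (by positivity), ← Real.rpow_natCast, ← Real.rpow_mul (abs_nonneg _),
    show (1 - 2 * s / (n : ℝ)) * (2 * s / n * (n / (n - 2 * s))) = 2 * s / n by
      field_simp,
    show (1 - 2 * s / (n : ℝ)) * (n / (n - 2 * s)) = 1 by field_simp, Real.rpow_one,
    show ((2 : ℕ) : ℝ) * (n / (n - 2 * s)) = 2 * (n : ℝ) / (n - 2 * s) by push_cast; ring] at hpow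
  have := ENNReal.ofReal_le_ofReal hpow
  rw [← ENNReal.ofReal_rpow_of_nonneg (abs_nonneg _) (by positivity), ← Real.enorm_eq_ofReal_abs,
    ENNReal.ofReal_mul (by positivity), ENNReal.ofReal_mul (by positivity), ← hDt,
    ← ENNReal.ofReal_rpow_of_nonneg ENNReal.toReal_nonneg hβ0.le, ← hIt, ← mul_assoc] at this
  exact this

theorem lintegral_lintegral_diffK {u : EuclideanSpace ℝ (Fin n) → ℝ}
    (hu : AEStronglyMeasurable (diffK K u)) :
    ∫⁻ x, ∫⁻ y, ‖diffK K u (x, y)‖ₑ ^ 2 = ∫⁻ z, ‖diffK K u z‖ₑ ^ 2 :=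
  (lintegral_prod _ (hu.enorm.pow_const 2)).symm

/-- Integrating the pointwise bound gives I ≤ C I^{2s/n} ∫|diffK K u|². As I is finite and 2s/n < 1,
the factor I^{2s/n} can be divided out unless I = 0. -/
theorem IsKernel.exists_lintegral_rpow_le_of_finite (hK : IsKernel s K) (hs : 0 < s)
    (hn : 2 * s < (n : ℝ)) :
    ∃ C : ℝ, 0 < C ∧ ∀ u v : EuclideanSpace ℝ (Fin n) → ℝ, AEMeasurable v →
      (∀ x y, |v x - v y| ≤ |u x - u y|) → MemLp (diffK K u) 2 →
      ∫⁻ y, ‖v y‖ₑ ^ (2 * (n : ℝ) / ((n : ℝ) - 2 * s)) ≠ ∞ →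
      ∫⁻ y, ‖v y‖ₑ ^ (2 * (n : ℝ) / ((n : ℝ) - 2 * s)) ≤
        (ENNReal.ofReal C * ∫⁻ z, ‖diffK K u z‖ₑ ^ 2) ^ ((n : ℝ) / (n - 2 * s)) := by
  have hn0 : (0 : ℝ) < n := by linarith
  have h2 : (0 : ℝ) < n - 2 * s := by linarith
  have hβ0 : 0 < 2 * s / (n : ℝ) := by positivity
  obtain ⟨C, hC, hpt⟩ := hK.exists_enorm_rpow_le hs hn
  refine ⟨C, hC, fun u v hv huv hu hI => ?_⟩
  set I := ∫⁻ y, ‖v y‖ₑ ^ (2 * (n : ℝ) / ((n : ℝ) - 2 * s)) with hIdef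
  have hfin : ∫⁻ z, ‖diffK K u z‖ₑ ^ 2 ≠ ∞ := by
    have := lintegral_rpow_enorm_lt_top_of_eLpNorm_lt_top (by simp) (by simp) hu.2
    simpa using this.ne
  have hDm : AEMeasurable (fun x => ∫⁻ y, ‖diffK K u (x, y)‖ₑ ^ 2) :=
    (hu.1.enorm.pow_const 2).lintegral_prod_right'
  have hae : ∀ᵐ x, ∫⁻ y, ‖diffK K u (x, y)‖ₑ ^ 2 ≠ ∞ := by
    refine (ae_lt_top' hDm ?_).mono fun x hx => hx.ne
    rwa [lintegral_lintegral_diffK hu.1]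
  have hIt : I ^ (2 * s / (n : ℝ)) ≠ ∞ := ENNReal.rpow_ne_top_of_nonneg hβ0.le hI
  have h3 : I ≤ ENNReal.ofReal C * I ^ (2 * s / (n : ℝ)) * ∫⁻ z, ‖diffK K u z‖ₑ ^ 2 := by
    rw [← lintegral_lintegral_diffK hu.1,
      ← lintegral_const_mul' _ _ (ENNReal.mul_ne_top ENNReal.ofReal_ne_top hIt), hIdef]
    exact lintegral_mono_ae (hae.mono fun x hx => hpt u v hv huv hI x hx)
  rcases eq_or_ne I 0 with h0 | h0
  · rw [h0]; exact zero_le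
  have h4 : I ^ (1 - 2 * s / (n : ℝ)) ≤ ENNReal.ofReal C * ∫⁻ z, ‖diffK K u z‖ₑ ^ 2 := by
    rw [ENNReal.rpow_sub _ _ h0 hI, ENNReal.rpow_one]
    refine ENNReal.div_le_of_le_mul ?_
    rwa [mul_right_comm] at h3
  calc I = (I ^ (1 - 2 * s / (n : ℝ))) ^ ((n : ℝ) / (n - 2 * s)) := by
        rw [← ENNReal.rpow_mul, show (1 - 2 * s / (n : ℝ)) * (n / (n - 2 * s)) = 1 by field_simp,
          ENNReal.rpow_one]
    _ ≤ _ := ENNReal.rpow_le_rpow h4 (by positivity)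

/-- The fractional Sobolev inequality for the kernel `K`. -/
theorem IsKernel.exists_lintegral_rpow_le (hK : IsKernel s K) (hs : 0 < s)
    (hn : 2 * s < (n : ℝ)) :
    ∃ C : ℝ, 0 < C ∧ ∀ u : EuclideanSpace ℝ (Fin n) → ℝ, MemLp u 2 → MemLp (diffK K u) 2 →
      ∫⁻ y, ‖u y‖ₑ ^ (2 * (n : ℝ) / ((n : ℝ) - 2 * s)) ≤
        (ENNReal.ofReal C * ∫⁻ z, ‖diffK K u z‖ₑ ^ 2) ^ ((n : ℝ) / (n - 2 * s)) := by
  have hn0 : (0 : ℝ) < n := by linarith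
  have h2 : (0 : ℝ) < n - 2 * s := by linarith
  have hq : 2 < 2 * (n : ℝ) / (n - 2 * s) := by rw [lt_div_iff₀ h2]; linarith
  obtain ⟨C, hC, hS⟩ := hK.exists_lintegral_rpow_le_of_finite hs hn
  refine ⟨C, hC, fun u hu hdu => ?_⟩
  set q := 2 * (n : ℝ) / (n - 2 * s) with hqdef
  -- Truncation at height T makes the critical integral finite, because |v|^q ≤ T^{q-2}|u|² and u ∈
  -- L². The resulting bound is independent of T, so Fatou's lemma transfers it to u.
  set v : ℕ → EuclideanSpace ℝ (Fin n) → ℝ := fun T x => min |u x| T with hvdef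
  have hvm : ∀ T, AEMeasurable (v T) := fun T =>
    (hu.1.aemeasurable.abs).min aemeasurable_const
  have hv0 : ∀ T x, 0 ≤ v T x := fun T x => le_min (abs_nonneg _) (Nat.cast_nonneg _)
  have hbound : ∀ T, ∫⁻ y, ‖v T y‖ₑ ^ q ≤
      (ENNReal.ofReal C * ∫⁻ z, ‖diffK K u z‖ₑ ^ 2) ^ ((n : ℝ) / (n - 2 * s)) := fun T => by
    refine hS u (v T) (hvm T) (fun x y => ?_) hdu ?_
    · refine (abs_min_sub_min_le_max _ _ _ _).trans (max_le (abs_abs_sub_abs_le _ _) ?_)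
      simp
    · have hfin : ∫⁻ y, ‖u y‖ₑ ^ (2 : ℝ) ≠ ∞ := by
        have := lintegral_rpow_enorm_lt_top_of_eLpNorm_lt_top (by simp) (by simp) hu.2
        simpa using this.ne
      refine ne_top_of_le_ne_top (ENNReal.mul_ne_top (ENNReal.rpow_ne_top_of_nonneg
        (by linarith : 0 ≤ q - 2) (ENNReal.natCast_ne_top T)) hfin) ?_
      rw [← lintegral_const_mul' _ _ (ENNReal.rpow_ne_top_of_nonneg
        (by linarith : 0 ≤ q - 2) (ENNReal.natCast_ne_top T))]
      refine lintegral_mono fun y => ?_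
      have e1 : ‖v T y‖ₑ ≤ T := by
        rw [Real.enorm_of_nonneg (hv0 T y)]
        exact (ENNReal.ofReal_le_ofReal (min_le_right _ _)).trans_eq (ENNReal.ofReal_natCast T)
      have e2 : ‖v T y‖ₑ ≤ ‖u y‖ₑ := by
        rw [Real.enorm_of_nonneg (hv0 T y), Real.enorm_eq_ofReal_abs]
        exact ENNReal.ofReal_le_ofReal (min_le_left _ _)
      calc ‖v T y‖ₑ ^ q = ‖v T y‖ₑ ^ (q - 2) * ‖v T y‖ₑ ^ (2 : ℝ) := by
            rw [← ENNReal.rpow_add_of_nonneg _ _ (by linarith) (by norm_num), sub_add_cancel]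
        _ ≤ _ := by
          gcongr
  refine le_trans ?_ (liminf_le_of_frequently_le' (f := atTop)
    (u := fun T => ∫⁻ y, ‖v T y‖ₑ ^ q) (Eventually.of_forall hbound).frequently)
  refine le_trans (lintegral_mono_ae ?_) (lintegral_liminf_le' fun T =>
    ((hvm T).enorm.pow_const q))
  refine Eventually.of_forall fun y => ?_
  obtain ⟨T₀, hT₀⟩ := exists_nat_ge |u y|
  refine le_liminf_of_le (by isBoundedDefault) ?_
  filter_upwards [eventually_ge_atTop T₀] with T hT
  have : v T y = |u y| := min_eq_left (hT₀.trans (by exact_mod_cast hT))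
  rw [this, Real.enorm_eq_ofReal_abs, Real.enorm_eq_ofReal_abs, abs_abs]

end Sobolev

/-! ### E as a separable Hilbert space, and weak compactness -/

section

open scoped ENNReal

variable {n : ℕ} {s : ℝ} {K V : EuclideanSpace ℝ (Fin n) → ℝ}

namespace EnergySpace

variable {hK : IsKernel s K} {hV : IsPotential V}

theorem inner_def (u v : EnergySpace hK hV) :
    inner ℝ u v = gagliardo u v + potentialForm u v := rfl

/-- The linear map `u ↦ (u x - u y) √K(x - y)` from `E` to `L²(ℝⁿ × ℝⁿ)`. -/
def diffLin : EnergySpace hK hV →ₗ[ℝ]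
    Lp ℝ 2 (volume : Measure (EuclideanSpace ℝ (Fin n) × EuclideanSpace ℝ (Fin n))) where
  toFun u := u.memLp_diffK.toLp _
  map_add' u v := by
    rw [← MemLp.toLp_add, MemLp.toLp_eq_toLp_iff, ← diffK_add]
    exact diffK_congr K (coe_add u v)
  map_smul' c u := by
    rw [RingHom.id_apply, ← MemLp.toLp_const_smul, MemLp.toLp_eq_toLp_iff, ← diffK_smul]
    exact diffK_congr K (coe_smul c u)

theorem coeFn_diffLin (u : EnergySpace hK hV) : diffLin u =ᵐ[volume] diffK K u :=
  u.memLp_diffK.coeFn_toLp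

/-- The linear map `u ↦ √V u` from `E` to `L²(ℝⁿ)`. -/
def potLin : EnergySpace hK hV →ₗ[ℝ]
    Lp ℝ 2 (volume : Measure (EuclideanSpace ℝ (Fin n))) where
  toFun u := u.memLp_potential.toLp _
  map_add' u v := by
    rw [← MemLp.toLp_add, MemLp.toLp_eq_toLp_iff]
    filter_upwards [coe_add u v] with x hx
    simp only [hx, Pi.add_apply, mul_add]
  map_smul' c u := by
    rw [RingHom.id_apply, ← MemLp.toLp_const_smul, MemLp.toLp_eq_toLp_iff]
    filter_upwards [coe_smul c u] with x hx
    simp only [hx, Pi.smul_apply, smul_eq_mul]; ring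

theorem coeFn_potLin (u : EnergySpace hK hV) : potLin u =ᵐ[volume] fun x => √(V x) * u x :=
  u.memLp_potential.coeFn_toLp

theorem inner_diffLin (u v : EnergySpace hK hV) :
    inner ℝ (diffLin u) (diffLin v) = gagliardo u v := by
  rw [gagliardo_eq, L2.inner_def]
  refine integral_congr_ae ?_
  filter_upwards [coeFn_diffLin u, coeFn_diffLin v] with z h1 h2
  simp [h1, h2, mul_comm]

theorem inner_potLin (u v : EnergySpace hK hV) :
    inner ℝ (potLin u) (potLin v) = potentialForm u v := by
  rw [potentialForm_eq, L2.inner_def]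
  refine integral_congr_ae ?_
  filter_upwards [coeFn_potLin u, coeFn_potLin v] with z h1 h2
  simp only [h1, h2, RCLike.inner_apply, conj_trivial]; ring

theorem norm_sq_eq_add (u : EnergySpace hK hV) :
    ‖u‖ ^ 2 = ‖diffLin u‖ ^ 2 + ‖potLin u‖ ^ 2 := by
  rw [← real_inner_self_eq_norm_sq, ← real_inner_self_eq_norm_sq, ← real_inner_self_eq_norm_sq,
    inner_diffLin, inner_potLin, inner_def]

theorem norm_diffLin_le (u : EnergySpace hK hV) : ‖diffLin u‖ ≤ ‖u‖ :=
  (abs_le_of_sq_le_sq' (by nlinarith [norm_sq_eq_add u, sq_nonneg ‖potLin u‖]) (norm_nonneg _)).2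

theorem norm_potLin_le (u : EnergySpace hK hV) : ‖potLin u‖ ≤ ‖u‖ :=
  (abs_le_of_sq_le_sq' (by nlinarith [norm_sq_eq_add u, sq_nonneg ‖diffLin u‖]) (norm_nonneg _)).2

/-- `diffLin` as a continuous linear map. -/
def diffCLM : EnergySpace hK hV →L[ℝ]
    Lp ℝ 2 (volume : Measure (EuclideanSpace ℝ (Fin n) × EuclideanSpace ℝ (Fin n))) :=
  diffLin.mkContinuous 1 fun u => by simpa using norm_diffLin_le u

/-- `potLin` as a continuous linear map. -/
def potCLM : EnergySpace hK hV →L[ℝ] Lp ℝ 2 (volume : Measure (EuclideanSpace ℝ (Fin n))) :=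
  potLin.mkContinuous 1 fun u => by simpa using norm_potLin_le u

theorem exists_norm_toL2_le (hK : IsKernel s K) (hV : IsPotential V) :
    ∃ C : ℝ, ∀ u : EnergySpace hK hV, ‖u.toL2‖ ≤ C * ‖u‖ := by
  obtain ⟨V₀, h0, hV0⟩ := hV.lower
  refine ⟨(√V₀)⁻¹, fun u => ?_⟩
  have hs : 0 < √V₀ := Real.sqrt_pos.2 h0
  refine le_trans ?_ (mul_le_mul_of_nonneg_left (norm_potLin_le u) (by positivity))
  refine Lp.norm_le_mul_norm_of_ae_le_mul ?_
  filter_upwards [coeFn_potLin u] with x hx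
  rw [hx, norm_mul, Real.norm_of_nonneg (Real.sqrt_nonneg _), ← mul_assoc]
  refine le_mul_of_one_le_left (norm_nonneg _) ?_
  rw [inv_mul_eq_div, one_le_div hs]
  exact Real.sqrt_le_sqrt (hV0 x)

/-- The inclusion of `E` in `L²(ℝⁿ)` as a continuous linear map. -/
def toL2CLM : EnergySpace hK hV →L[ℝ] Lp ℝ 2 (volume : Measure (EuclideanSpace ℝ (Fin n))) :=
  LinearMap.mkContinuousOfExistsBound
    { toFun := toL2, map_add' := fun _ _ => rfl, map_smul' := fun _ _ => rfl }
    (exists_norm_toL2_le hK hV)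

theorem ae_eq_of_tendsto_of_ae_tendsto {X : Type*} [MeasurableSpace X] {μ : Measure X}
    {f : ℕ → Lp ℝ 2 μ} {g : Lp ℝ 2 μ} {h : X → ℝ} (hf : Tendsto f atTop (𝓝 g))
    (hae : ∀ᵐ x ∂μ, Tendsto (fun m => f m x) atTop (𝓝 (h x))) : g =ᵐ[μ] h := by
  obtain ⟨φ, hφ, hφae⟩ := (tendstoInMeasure_of_tendsto_Lp hf).exists_seq_tendsto_ae
  filter_upwards [hae, hφae] with x h1 h2
  exact tendsto_nhds_unique h2 (h1.comp hφ.tendsto_atTop)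

theorem ae_tendsto_diffK {u : ℕ → EuclideanSpace ℝ (Fin n) → ℝ}
    {w : EuclideanSpace ℝ (Fin n) → ℝ}
    (h : ∀ᵐ x, Tendsto (fun m => u m x) atTop (𝓝 (w x))) :
    ∀ᵐ z, Tendsto (fun m => diffK K (u m) z) atTop (𝓝 (diffK K w z)) := by
  have h1 := (Measure.quasiMeasurePreserving_fst (μ := volume) (ν := volume)
    (α := EuclideanSpace ℝ (Fin n)) (β := EuclideanSpace ℝ (Fin n))).ae h
  have h2 := (Measure.quasiMeasurePreserving_snd (μ := volume) (ν := volume)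
    (α := EuclideanSpace ℝ (Fin n)) (β := EuclideanSpace ℝ (Fin n))).ae h
  filter_upwards [h1, h2] with z hz1 hz2
  exact (hz1.sub hz2).mul_const _

/-- Along a Cauchy sequence u, √V u and `diffK K u` converge in their L² spaces; an almost
everywhere convergent subsequence identifies the last two limits with √V w and `diffK K w`. -/
instance : CompleteSpace (EnergySpace hK hV) := by
  refine Metric.complete_of_cauchySeq_tendsto fun u hu => ?_
  obtain ⟨w, hw⟩ := cauchySeq_tendsto_of_complete (toL2CLM.uniformContinuous.comp_cauchySeq hu)
  obtain ⟨a, ha⟩ := cauchySeq_tendsto_of_complete (potCLM.uniformContinuous.comp_cauchySeq hu)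
  obtain ⟨b, hb⟩ := cauchySeq_tendsto_of_complete (diffCLM.uniformContinuous.comp_cauchySeq hu)
  obtain ⟨φ, hφ, hae⟩ := (tendstoInMeasure_of_tendsto_Lp hw).exists_seq_tendsto_ae
  have hae' : ∀ᵐ x, Tendsto (fun m => u (φ m) x) atTop (𝓝 (w x)) := hae
  have hb' : b =ᵐ[volume] diffK K w := by
    refine ae_eq_of_tendsto_of_ae_tendsto (hb.comp hφ.tendsto_atTop) ?_
    filter_upwards [ae_tendsto_diffK (K := K) hae',
      ae_all_iff.2 fun m => coeFn_diffLin (u (φ m))] with z h1 h2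
    exact h1.congr fun m => (h2 m).symm
  have ha' : a =ᵐ[volume] fun x => √(V x) * w x := by
    refine ae_eq_of_tendsto_of_ae_tendsto (ha.comp hφ.tendsto_atTop) ?_
    filter_upwards [hae', ae_all_iff.2 fun m => coeFn_potLin (u (φ m))] with z h1 h2
    exact (h1.const_mul (√(V z))).congr fun m => (h2 m).symm
  let W : EnergySpace hK hV := ⟨w, (memLp_congr_ae hb').1 (Lp.memLp b),
    (integrable_potential_iff hV w).2 ((memLp_congr_ae ha').1 (Lp.memLp a))⟩
  have hbW : diffLin W = b := Lp.ext ((coeFn_diffLin W).trans hb'.symm)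
  have haW : potLin W = a := Lp.ext ((coeFn_potLin W).trans ha'.symm)
  refine ⟨W, ?_⟩
  rw [tendsto_iff_norm_sub_tendsto_zero] at ha hb ⊢
  have h3 : Tendsto (fun m => ‖u m - W‖ ^ 2) atTop (𝓝 0) := by
    have := (hb.pow 2).add (ha.pow 2)
    simp only [ne_eq, OfNat.ofNat_ne_zero, not_false_eq_true, zero_pow, add_zero] at this
    refine this.congr fun m => ?_
    rw [norm_sq_eq_add, map_sub, map_sub, hbW, haW]
    rfl
  have h4 := h3.sqrt
  simpa [Real.sqrt_sq] using h4

/-- The pair (`diffCLM`, `potCLM`) embeds E topologically in a product of two second countable L²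
spaces. Separability is what makes bounded sets weakly sequentially compact below. -/
instance : TopologicalSpace.SeparableSpace (EnergySpace hK hV) := by
  have hanti : AntilipschitzWith 2
      ((diffCLM (hK := hK) (hV := hV)).prod potCLM) := by
    refine ContinuousLinearMap.antilipschitz_of_bound _ fun u => ?_
    have h1 : ‖diffLin u‖ ≤ ‖(diffCLM u, potCLM u)‖ := norm_fst_le (diffCLM u, potCLM u)
    have h2 : ‖potLin u‖ ≤ ‖(diffCLM u, potCLM u)‖ := norm_snd_le (diffCLM u, potCLM u)
    have h3 := norm_sq_eq_add u
    refine (abs_le_of_sq_le_sq' ?_ (by positivity)).2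
    change ‖u‖ ^ 2 ≤ (2 * ‖(diffCLM u, potCLM u)‖) ^ 2
    nlinarith [norm_nonneg (diffLin u), norm_nonneg (potLin u)]
  have : Fact ((2 : ℝ≥0∞) ≠ ∞) := ⟨by simp⟩
  have : MeasurableSpace.CountablyGenerated
      (EuclideanSpace ℝ (Fin n) × EuclideanSpace ℝ (Fin n)) := inferInstance
  have : SFinite (volume : Measure (EuclideanSpace ℝ (Fin n) × EuclideanSpace ℝ (Fin n))) :=
    inferInstance
  have hind := (hanti.isUniformInducing
    ((diffCLM (hK := hK) (hV := hV)).prod potCLM).uniformContinuous).isInducing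
  have := hind.secondCountableTopology
  infer_instance

end EnergySpace

/-- Sequential Banach–Alaoglu in the dual, transported by the Riesz isomorphism. -/
theorem exists_weakly_convergent_subseq {H : Type*} [NormedAddCommGroup H] [InnerProductSpace ℝ H]
    [CompleteSpace H] [TopologicalSpace.SeparableSpace H] {u : ℕ → H} {M : ℝ}
    (hu : ∀ m, ‖u m‖ ≤ M) :
    ∃ w : H, ∃ φ : ℕ → ℕ, StrictMono φ ∧
      ∀ v : H, Tendsto (fun m => inner ℝ (u (φ m)) v) atTop (𝓝 (inner ℝ w v)) := by
  obtain ⟨a, -, φ, hφ, ha⟩ := WeakDual.isSeqCompact_closedBall ℝ H (0 : StrongDual ℝ H) M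
    (x := fun m => StrongDual.toWeakDual (InnerProductSpace.toDual ℝ H (u m)))
    (fun m => by simpa using hu m)
  refine ⟨(InnerProductSpace.toDual ℝ H).symm (WeakDual.toStrongDual a), φ, hφ, fun v => ?_⟩
  rw [InnerProductSpace.toDual_symm_apply]
  have := (WeakDual.eval_continuous v).tendsto a |>.comp ha
  exact this

end

/-! ### Embeddings of E in L^r, and the splitting of g -/

section

open scoped ENNReal

variable {n : ℕ} {s p θ R : ℝ} {K V : EuclideanSpace ℝ (Fin n) → ℝ} {f : ℝ → ℝ}

namespace EnergySpace

variable {hK : IsKernel s K} {hV : IsPotential V}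

theorem lintegral_rpow_critical_ne_top (hs : 0 < s) (hn : 2 * s < (n : ℝ))
    (u : EnergySpace hK hV) :
    ∫⁻ y, ‖u y‖ₑ ^ (2 * (n : ℝ) / ((n : ℝ) - 2 * s)) ≠ ∞ := by
  obtain ⟨C, hC, hS⟩ := hK.exists_lintegral_rpow_le hs hn
  refine ne_top_of_le_ne_top (ENNReal.rpow_ne_top_of_nonneg
    (div_nonneg (by linarith) (by linarith)) (ENNReal.mul_ne_top ENNReal.ofReal_ne_top ?_))
    (hS u (Lp.memLp u.toL2) u.memLp_diffK)
  have := lintegral_rpow_enorm_lt_top_of_eLpNorm_lt_top (by simp) (by simp) u.memLp_diffK.2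
  simpa using this.ne

/-- Functions in `E` are in `L^r` for `2 ≤ r ≤ 2n / (n - 2s)`. -/
theorem memLp_of_le (hs : 0 < s) (hn : 2 * s < (n : ℝ)) {r : ℝ} (hr : 2 ≤ r)
    (hr' : r ≤ 2 * (n : ℝ) / ((n : ℝ) - 2 * s)) (u : EnergySpace hK hV) :
    MemLp u (ENNReal.ofReal r) volume := by
  refine ⟨Lp.aestronglyMeasurable u.toL2, ?_⟩
  rw [eLpNorm_lt_top_iff_lintegral_rpow_enorm_lt_top (by simp; linarith) ENNReal.ofReal_ne_top,
    ENNReal.toReal_ofReal (by linarith)]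
  have h2 : ∫⁻ y, ‖u y‖ₑ ^ (2 : ℝ) ≠ ∞ := by
    have := lintegral_rpow_enorm_lt_top_of_eLpNorm_lt_top (by simp) (by simp)
      (Lp.memLp u.toL2).2
    simpa using this.ne
  refine lt_of_le_of_lt ?_ (ENNReal.add_lt_top.2
    ⟨h2.lt_top, (lintegral_rpow_critical_ne_top hs hn u).lt_top⟩)
  rw [← lintegral_add_left' ((Lp.aestronglyMeasurable u.toL2).enorm.pow_const _)]
  refine lintegral_mono fun y => ?_
  -- The power r is dominated by the square where |u| ≤ 1 and by the critical power elsewhere.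
  rcases le_total ‖u y‖ₑ 1 with h | h
  · exact (ENNReal.rpow_le_rpow_of_exponent_ge h hr).trans le_self_add
  · exact (ENNReal.rpow_le_rpow_of_exponent_le h hr').trans le_add_self

/-- If `E` is contained in `L^r`, the inclusion is continuous. -/
def inclusion {r : ℝ≥0∞} [Fact (1 ≤ r)] (hm : ∀ u : EnergySpace hK hV, MemLp u r volume) :
    EnergySpace hK hV →L[ℝ] Lp ℝ r (volume : Measure (EuclideanSpace ℝ (Fin n))) :=
  ContinuousLinearMap.ofSeqClosedGraph
    (g := { toFun := fun u => (hm u).toLp _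
            map_add' := fun u v => by
              rw [← MemLp.toLp_add, MemLp.toLp_eq_toLp_iff]
              exact coe_add u v
            map_smul' := fun c u => by
              rw [RingHom.id_apply, ← MemLp.toLp_const_smul, MemLp.toLp_eq_toLp_iff]
              exact coe_smul c u }) (by
    -- Closed graph: convergence in E gives the almost everywhere limit w along a subsequence,
    -- through L²; a further subsequence tends almost everywhere to the L^r limit y.
    intro u w y hu hy
    obtain ⟨φ, hφ, h1⟩ := (tendstoInMeasure_of_tendsto_Lp
      ((toL2CLM.continuous.tendsto w).comp hu)).exists_seq_tendsto_ae
    obtain ⟨ψ, hψ, h2⟩ := (tendstoInMeasure_of_tendsto_Lp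
      (hy.comp hφ.tendsto_atTop)).exists_seq_tendsto_ae
    refine Lp.ext (EventuallyEq.trans ?_ (hm w).coeFn_toLp.symm)
    filter_upwards [h1, h2, ae_all_iff.2 fun m => (hm (u (φ (ψ m)))).coeFn_toLp] with x h3 h4 h5
    exact tendsto_nhds_unique (h4.congr h5) (h3.comp hψ.tendsto_atTop))

theorem coeFn_inclusion {r : ℝ≥0∞} [Fact (1 ≤ r)]
    (hm : ∀ u : EnergySpace hK hV, MemLp u r volume) (u : EnergySpace hK hV) :
    inclusion hm u =ᵐ[volume] u := (hm u).coeFn_toLp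

end EnergySpace

namespace IsNonlinearity

theorem apply_zero (hf : IsNonlinearity p θ f) (hp : 2 < p) : f 0 = 0 := by
  obtain ⟨c, -, h⟩ := hf.growth
  have := h 0
  rw [abs_zero, Real.zero_rpow (by linarith), mul_zero] at this
  exact abs_nonpos_iff.1 this

theorem nonneg (hf : IsNonlinearity p θ f) (hp : 2 < p) (t : ℝ) : 0 ≤ f t := by
  rcases lt_trichotomy t 0 with h | rfl | h
  · exact (hf.zero t h).ge
  · exact (hf.apply_zero hp).ge
  · exact (hf.pos t h).le

end IsNonlinearity

/-- As a minimum, the truncation is visibly continuous in t and jointly measurable, which the case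
distinction hides. -/
theorem truncated_eq_min (hθ : 2 < θ) (v t : ℝ) :
    truncated θ f v t = min (f t) (v / (2 * θ / (θ - 2)) * t) := by
  have hk : 0 < 2 * θ / (θ - 2) := div_pos (by linarith) (by linarith)
  have : 2 * θ / (θ - 2) * f t ≤ v * t ↔ f t ≤ v / (2 * θ / (θ - 2)) * t := by
    rw [div_mul_eq_mul_div v, le_div_iff₀ hk, mul_comm]
  unfold truncated
  simp only [this]
  split_ifs with h
  · exact (min_eq_left h).symm
  · exact (min_eq_right (not_le.1 h).le).symm

/-- For t < 0 the bound is an equality: f vanishes there, so the minimum is the linear branch (v/k)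
t and not 0. -/
theorem abs_truncated_le (hf : IsNonlinearity p θ f) (hp : 2 < p) (hθ : 2 < θ) {v : ℝ}
    (hv : 0 ≤ v) (t : ℝ) : |truncated θ f v t| ≤ v / (2 * θ / (θ - 2)) * |t| := by
  have hk : 0 < 2 * θ / (θ - 2) := div_pos (by linarith) (by linarith)
  have hvk : 0 ≤ v / (2 * θ / (θ - 2)) := by positivity
  rw [truncated_eq_min hθ]
  rcases le_or_gt 0 t with h | h
  · rw [abs_of_nonneg h, abs_of_nonneg (le_min (hf.nonneg hp t) (by positivity))]
    exact min_le_right _ _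
  · rw [hf.zero t h, min_eq_right (by nlinarith), abs_mul, abs_of_nonneg hvk]

/-- The part of the penalized nonlinearity inside the ball of radius `R`. -/
def innerPart (R : ℝ) (f : ℝ → ℝ) (x : EuclideanSpace ℝ (Fin n)) (t : ℝ) : ℝ :=
  open Classical in if ‖x‖ ≤ R then f t else 0

/-- The part of the penalized nonlinearity outside the ball of radius `R`, as a function
of `√(V x) t`. -/
def outerPart (θ R : ℝ) (f : ℝ → ℝ) (V : EuclideanSpace ℝ (Fin n) → ℝ)
    (x : EuclideanSpace ℝ (Fin n)) (t : ℝ) : ℝ :=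
  open Classical in if ‖x‖ ≤ R then 0 else truncated θ f (V x) (t / √(V x)) / √(V x)

theorem isPowerCaratheodory_innerPart (hf : IsNonlinearity p θ f) :
    IsPowerCaratheodory p (innerPart (n := n) R f) := by
  refine ⟨?_, fun x => ?_, ?_⟩
  · exact Measurable.ite (measurableSet_le measurable_fst.norm measurable_const)
      (hf.continuous.measurable.comp measurable_snd) measurable_const
  · unfold innerPart
    split_ifs
    exacts [hf.continuous, continuous_const]
  · obtain ⟨c, hc, h⟩ := hf.growth
    refine ⟨c, hc.le, fun x t => ?_⟩
    unfold innerPart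
    split_ifs
    · exact h t
    · rw [abs_zero]; positivity

/-- The rescaling cancels V: |f̃(x, t/√V)|/√V ≤ (V/k)|t|/V = |t|/k, uniformly in x. -/
theorem isPowerCaratheodory_outerPart (hf : IsNonlinearity p θ f) (hp : 2 < p) (hθ : 2 < θ)
    (hV : IsPotential V) : IsPowerCaratheodory 2 (outerPart θ R f V) := by
  have hk : 0 < 2 * θ / (θ - 2) := div_pos (by linarith) (by linarith)
  obtain ⟨V₀, h0, hV0⟩ := hV.lower
  refine ⟨?_, fun x => ?_, (2 * θ / (θ - 2))⁻¹, by positivity, fun x t => ?_⟩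
  · have hVm : Measurable fun z : EuclideanSpace ℝ (Fin n) × ℝ => V z.1 :=
      hV.continuous.measurable.comp measurable_fst
    refine Measurable.ite (measurableSet_le measurable_fst.norm measurable_const)
      measurable_const ?_
    simp only [truncated_eq_min hθ]
    have ht : Measurable fun z : EuclideanSpace ℝ (Fin n) × ℝ => z.2 / √(V z.1) :=
      measurable_snd.div hVm.sqrt
    exact ((hf.continuous.measurable.comp ht).min ((hVm.div_const _).mul ht)).div hVm.sqrt
  · unfold outerPart
    split_ifs
    · exact continuous_const
    · simp only [truncated_eq_min hθ]
      have ht : Continuous fun t : ℝ => t / √(V x) := continuous_id.div_const _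
      exact ((hf.continuous.comp ht).min (continuous_const.mul ht)).div_const _
  · unfold outerPart
    split_ifs
    · rw [abs_zero]; positivity
    have hv : 0 < V x := h0.trans_le (hV0 x)
    have hv' : 0 < √(V x) := Real.sqrt_pos.2 hv
    rw [abs_div, abs_of_pos hv', div_le_iff₀ hv']
    refine (abs_truncated_le hf hp hθ hv.le _).trans_eq ?_
    rw [abs_div, abs_of_pos hv']
    norm_num
    have := Real.sq_sqrt hv.le
    field_simp
    rw [this]; ring

theorem penalized_eq_add (hV : IsPotential V) (x : EuclideanSpace ℝ (Fin n)) (t : ℝ) :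
    penalized θ R f V x t = innerPart R f x t + √(V x) * outerPart θ R f V x (√(V x) * t) := by
  obtain ⟨V₀, h0, hV0⟩ := hV.lower
  have hv' : 0 < √(V x) := Real.sqrt_pos.2 (h0.trans_le (hV0 x))
  unfold penalized innerPart outerPart
  split_ifs
  · simp
  · rw [mul_div_cancel_left₀ _ hv'.ne', zero_add, mul_div_cancel₀ _ hv'.ne']

/-- Outside the ball, substitute τ = σ/√V; the Jacobian cancels the factor 1/√V in `outerPart`. -/
theorem primitive_penalized_eq_add (hV : IsPotential V) (x : EuclideanSpace ℝ (Fin n)) (t : ℝ) :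
    primitive (penalized θ R f V x) t =
      primitive (innerPart R f x) t + primitive (outerPart θ R f V x) (√(V x) * t) := by
  obtain ⟨V₀, h0, hV0⟩ := hV.lower
  have hv' : 0 < √(V x) := Real.sqrt_pos.2 (h0.trans_le (hV0 x))
  unfold primitive
  by_cases hx : ‖x‖ ≤ R
  · simp [penalized, innerPart, outerPart, hx]
  · simp only [penalized, innerPart, outerPart, hx, if_false, intervalIntegral.integral_zero,
      zero_add, intervalIntegral.integral_div]
    rw [intervalIntegral.integral_comp_div (fun t => truncated θ f (V x) t) hv'.ne', zero_div,
      mul_div_cancel_left₀ _ hv'.ne', smul_eq_mul, mul_div_cancel_left₀ _ hv'.ne']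

end

/-! ### J is of class C¹ -/

section

open scoped ENNReal

namespace IsPowerCaratheodory

variable {X : Type*} [MeasurableSpace X] {μ : Measure X} {p : ℝ} {h : X → ℝ → ℝ}

theorem integrable_mul (hh : IsPowerCaratheodory p h) (hp : 1 < p) {u v : X → ℝ}
    (hu : MemLp u (ENNReal.ofReal p) μ) (hv : MemLp v (ENNReal.ofReal p) μ) :
    Integrable (fun x => h x (u x) * v x) μ := by
  have hpq := Real.HolderConjugate.conjExponent hp
  have := hpq.symm.ennrealOfReal
  exact (hh.memLp hpq hu).integrable_mul hv

/-- Integral functionals of power growth are continuously differentiable on `L^p`. -/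
theorem exists_continuous_hasFDerivAt (hh : IsPowerCaratheodory p h) (hp : 1 < p)
    {P : ℝ≥0∞} [Fact (1 ≤ P)] (hP : P = ENNReal.ofReal p) :
    ∃ A : Lp ℝ P μ → Lp ℝ P μ →L[ℝ] ℝ, Continuous A ∧
      (∀ u, HasFDerivAt (fun u : Lp ℝ P μ => ∫ x, primitive (h x) (u x) ∂μ) (A u) u) ∧
      ∀ u v, A u v = ∫ x, h x (u x) * v x ∂μ := by
  subst hP
  have hpq := Real.HolderConjugate.conjExponent hp
  have : Fact (1 ≤ ENNReal.ofReal p.conjExponent) := ⟨by simpa using hpq.symm.lt.le⟩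
  exact ⟨hh.derivFunctional hpq, hh.continuous_derivFunctional hpq,
    hh.hasFDerivAt_integral_primitive hpq, hh.derivFunctional_apply hpq⟩

end IsPowerCaratheodory

variable {n : ℕ} {s p θ R : ℝ} {K V : EuclideanSpace ℝ (Fin n) → ℝ} {f : ℝ → ℝ}
  {hK : IsKernel s K} {hV : IsPotential V}

namespace EnergySpace

theorem memLp_potential' (u : EnergySpace hK hV) :
    MemLp (fun x => √(V x) * u x) (ENNReal.ofReal 2) volume := by
  simpa using u.memLp_potential

theorem integrable_primitive_innerPart (hf : IsNonlinearity p θ f) (hp : 2 < p)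
    {u : EnergySpace hK hV} (hu : MemLp u (ENNReal.ofReal p) volume) :
    Integrable (fun x => primitive (innerPart R f x) (u x)) volume :=
  (isPowerCaratheodory_innerPart hf).integrable_primitive (by linarith) hu

theorem integrable_primitive_outerPart (hf : IsNonlinearity p θ f) (hp : 2 < p) (hθ : 2 < θ)
    (u : EnergySpace hK hV) :
    Integrable (fun x => primitive (outerPart θ R f V x) (√(V x) * u x)) volume :=
  (isPowerCaratheodory_outerPart hf hp hθ hV).integrable_primitive one_lt_two u.memLp_potential'

theorem integrable_primitive_penalized (hf : IsNonlinearity p θ f) (hp : 2 < p) (hθ : 2 < θ)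
    {u : EnergySpace hK hV} (hu : MemLp u (ENNReal.ofReal p) volume) :
    Integrable (fun x => primitive (penalized θ R f V x) (u x)) volume := by
  simp only [primitive_penalized_eq_add hV]
  exact (integrable_primitive_innerPart hf hp hu).add (integrable_primitive_outerPart hf hp hθ u)

theorem integrable_innerPart_mul (hf : IsNonlinearity p θ f) (hp : 2 < p)
    {u v : EnergySpace hK hV} (hu : MemLp u (ENNReal.ofReal p) volume)
    (hv : MemLp v (ENNReal.ofReal p) volume) :
    Integrable (fun x => innerPart R f x (u x) * v x) volume :=
  (isPowerCaratheodory_innerPart hf).integrable_mul (by linarith) hu hv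

theorem integrable_outerPart_mul (hf : IsNonlinearity p θ f) (hp : 2 < p) (hθ : 2 < θ)
    (u v : EnergySpace hK hV) :
    Integrable (fun x => outerPart θ R f V x (√(V x) * u x) * (√(V x) * v x)) volume :=
  (isPowerCaratheodory_outerPart hf hp hθ hV).integrable_mul one_lt_two u.memLp_potential'
    v.memLp_potential'

theorem penalized_mul_eq_add (hV : IsPotential V) (x : EuclideanSpace ℝ (Fin n)) (a b : ℝ) :
    penalized θ R f V x a * b = innerPart R f x a * b +
      outerPart θ R f V x (√(V x) * a) * (√(V x) * b) := by
  rw [penalized_eq_add hV]; ring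

theorem integrable_penalized_mul (hf : IsNonlinearity p θ f) (hp : 2 < p) (hθ : 2 < θ)
    {u v : EnergySpace hK hV} (hu : MemLp u (ENNReal.ofReal p) volume)
    (hv : MemLp v (ENNReal.ofReal p) volume) :
    Integrable (fun x => penalized θ R f V x (u x) * v x) volume := by
  simp only [penalized_mul_eq_add hV]
  exact (integrable_innerPart_mul hf hp hu hv).add (integrable_outerPart_mul hf hp hθ u v)

end EnergySpace

open EnergySpace

/-- The chain rule along two bounded linear maps, E → L^p for the inner part and u ↦ √V u into L²
for the outer part; the derivatives inherit continuity in operator norm. -/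
theorem exists_continuous_hasFDerivAt_penalizedEnergy (hf : IsNonlinearity p θ f) (hp : 2 < p)
    (hθ : 2 < θ) (hm : ∀ u : EnergySpace hK hV, MemLp u (ENNReal.ofReal p) volume) :
    ∃ A : EnergySpace hK hV → EnergySpace hK hV →L[ℝ] ℝ, Continuous A ∧
      (∀ u, HasFDerivAt (penalizedEnergy θ R f hK hV) (A u) u) ∧
      ∀ u v, A u v = inner ℝ u v - ∫ x, penalized θ R f V x (u x) * v x := by
  have : Fact (1 ≤ ENNReal.ofReal p) := ⟨by simp; linarith⟩
  obtain ⟨A₁, hA₁, hd₁, he₁⟩ := (isPowerCaratheodory_innerPart (n := n) (R := R)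
    hf).exists_continuous_hasFDerivAt (μ := volume) (by linarith) rfl
  obtain ⟨A₂, hA₂, hd₂, he₂⟩ := (isPowerCaratheodory_outerPart (R := R) hf hp hθ
    hV).exists_continuous_hasFDerivAt (μ := volume) one_lt_two (P := 2) (by simp)
  have hJ : penalizedEnergy θ R f hK hV = fun u => 1 / 2 * ‖u‖ ^ 2 -
      ((∫ x, primitive (innerPart R f x) (inclusion hm u x)) +
        ∫ x, primitive (outerPart θ R f V x) (potCLM u x)) := by
    funext u
    unfold penalizedEnergy
    simp only [primitive_penalized_eq_add hV]
    rw [integral_add (integrable_primitive_innerPart hf hp (hm u))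
      (integrable_primitive_outerPart hf hp hθ u)]
    congr 2 <;> refine integral_congr_ae ?_
    · filter_upwards [coeFn_inclusion hm u] with x hx
      rw [hx]
    · filter_upwards [coeFn_potLin u] with x hx
      change _ = primitive _ (potLin u x)
      rw [hx]
  refine ⟨fun u => innerSL ℝ u - ((A₁ (inclusion hm u)).comp (inclusion hm) +
    (A₂ (potCLM u)).comp potCLM), ?_, fun u => ?_, fun u v => ?_⟩
  · refine (innerSL ℝ).continuous.sub (Continuous.add ?_ ?_)
    · exact (hA₁.comp (inclusion hm).continuous).clm_comp continuous_const
    · exact (hA₂.comp potCLM.continuous).clm_comp continuous_const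
  · rw [hJ]
    have h0 : HasFDerivAt (fun u : EnergySpace hK hV => 1 / 2 * ‖u‖ ^ 2) (innerSL ℝ u) u := by
      have := (hasStrictFDerivAt_norm_sq u).hasFDerivAt.const_mul (1 / 2)
      convert! this using 1
      ext v
      simp
    exact h0.sub (((hd₁ _).comp u (inclusion hm).hasFDerivAt).add
      ((hd₂ _).comp u potCLM.hasFDerivAt))
  · simp only [sub_apply, add_apply, ContinuousLinearMap.comp_apply, innerSL_apply_apply, he₁, he₂,
      penalized_mul_eq_add hV]
    rw [integral_add (integrable_innerPart_mul hf hp (hm u) (hm v))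
      (integrable_outerPart_mul hf hp hθ u v)]
    congr 2 <;> refine integral_congr_ae ?_
    · filter_upwards [coeFn_inclusion hm u, coeFn_inclusion hm v] with x h1 h2
      rw [h1, h2]
    · filter_upwards [coeFn_potLin u, coeFn_potLin v] with x h1 h2
      change outerPart θ R f V x (potLin u x) * potLin v x = _
      rw [h1, h2]

end

/-! ### Local compactness -/

section

open scoped ENNReal

/-- With b the mean of v, a² ≤ 2(a - b)² + 2b², and Jensen bounds (a - b)² by the mean of (a - v)².
In contrast to `enorm_sq_mul_measure_le`, only the integral of v is left, which passes to weak
limits. -/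
theorem sq_mul_measure_le {X : Type*} [MeasurableSpace X] {μ : Measure X} [IsFiniteMeasure μ]
    {v : X → ℝ} (hv : MemLp v 2 μ) (hμ : 0 < μ.real Set.univ) (a : ℝ) :
    a ^ 2 * μ.real Set.univ ≤
      2 * (∫ y, (a - v y) ^ 2 ∂μ) + 2 * (∫ y, v y ∂μ) ^ 2 / μ.real Set.univ := by
  set m := μ.real Set.univ with hm
  set b := (∫ y, v y ∂μ) / m with hb
  have hbm : ∫ y, v y ∂μ = b * m := by rw [hb]; field_simp
  have hvi : Integrable v μ := hv.integrable (by norm_num)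
  have hi : Integrable (fun y => a - v y) μ := (integrable_const a).sub hvi
  have h1 : (a - b) ^ 2 * m ≤ ∫ y, (a - v y) ^ 2 ∂μ := by
    -- Jensen by hand: integrate the tangent line of the square at a - b.
    have h2 : ∫ y, (2 * (a - b) * (a - v y) - (a - b) ^ 2) ∂μ = (a - b) ^ 2 * m := by
      rw [integral_sub (hi.const_mul _) (integrable_const _),
        integral_const_mul, integral_sub (integrable_const a) hvi, integral_const, integral_const,
        hbm, smul_eq_mul, smul_eq_mul, ← hm]
      ring
    rw [← h2]
    refine integral_mono ((hi.const_mul _).sub (integrable_const _))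
      ((memLp_const a).sub hv).integrable_sq fun y => ?_
    change 2 * (a - b) * (a - v y) - (a - b) ^ 2 ≤ (a - v y) ^ 2
    nlinarith [sq_nonneg (v y - b)]
  have h3 : 2 * (∫ y, v y ∂μ) ^ 2 / m = 2 * (b ^ 2 * m) := by rw [hbm]; field_simp
  rw [h3]
  nlinarith [sq_nonneg (a - 2 * b), mul_nonneg (sq_nonneg (a - 2 * b)) hμ.le]

variable {n : ℕ} {s : ℝ} {K V : EuclideanSpace ℝ (Fin n) → ℝ}

/-- C does not depend on r, so the energy term is small for small r; only the constant c in front of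
the average deteriorates. -/
theorem IsKernel.exists_enorm_sq_le_average (hK : IsKernel s K) (hs : 0 < s) :
    ∃ C : ℝ, 0 < C ∧ ∀ r : ℝ, 0 < r → ∃ c : ℝ, 0 < c ∧
      ∀ u : EuclideanSpace ℝ (Fin n) → ℝ, MemLp u 2 → ∀ x,
        ‖u x‖ₑ ^ 2 ≤ ENNReal.ofReal (C * r ^ (2 * s)) * (∫⁻ y, ‖diffK K u (x, y)‖ₑ ^ 2) +
          ENNReal.ofReal c * ‖∫ y in Metric.ball x r, u y‖ₑ ^ 2 := by
  obtain ⟨C₁, hC₁, hball⟩ := hK.exists_lintegral_ball_sub_le hs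
  set ω := (volume (Metric.ball (0 : EuclideanSpace ℝ (Fin n)) 1)).toReal with hω
  have hω0 : 0 < ω :=
    ENNReal.toReal_pos (Metric.measure_ball_pos _ _ one_pos).ne' measure_ball_lt_top.ne
  refine ⟨2 * C₁ / ω, by positivity, fun r hr => ?_⟩
  have hrn : 0 < r ^ (n : ℝ) := by positivity
  set b := r ^ (n : ℝ) * ω with hb
  have hb0 : 0 < b := by positivity
  refine ⟨2 / b ^ 2, by positivity, fun u hu x => ?_⟩
  set B := Metric.ball x r
  have hB : (volume.restrict B).real Set.univ = b := by
    rw [measureReal_restrict_apply_univ, Measure.real, volume_ball_eq_mul x hr, ENNReal.toReal_mul,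
      ENNReal.toReal_ofReal hrn.le]
  have : IsFiniteMeasure (volume.restrict B) := ⟨by
    rw [Measure.restrict_apply_univ]; exact measure_ball_lt_top⟩
  have h1 := sq_mul_measure_le (hu.restrict B) (by rw [hB]; exact hb0) (u x)
  rw [hB, ← le_div_iff₀ hb0] at h1
  have h2 := ENNReal.ofReal_le_ofReal h1
  have hI : ENNReal.ofReal (∫ y in B, (u x - u y) ^ 2) ≤
      ENNReal.ofReal (C₁ * r ^ ((n : ℝ) + 2 * s)) * ∫⁻ y, ‖diffK K u (x, y)‖ₑ ^ 2 := by
    have hi : Integrable (fun y => (u x - u y) ^ 2) (volume.restrict B) :=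
      ((memLp_const (u x)).sub (hu.restrict B)).integrable_sq
    rw [ofReal_integral_eq_lintegral_ofReal hi
      (Eventually.of_forall fun y => sq_nonneg _)]
    simp only [← enorm_sq_eq_ofReal]
    exact hball u x r hr
  have hI0 : 0 ≤ ∫ y in B, (u x - u y) ^ 2 := integral_nonneg fun y => sq_nonneg _
  rw [enorm_sq_eq_ofReal, enorm_sq_eq_ofReal]
  calc ENNReal.ofReal (u x ^ 2) ≤ ENNReal.ofReal (2 / b * (∫ y in B, (u x - u y) ^ 2) +
        2 / b ^ 2 * (∫ y in B, u y) ^ 2) := by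
        refine h2.trans_eq (congrArg _ ?_)
        field_simp
    _ = ENNReal.ofReal (2 / b) * ENNReal.ofReal (∫ y in B, (u x - u y) ^ 2) +
        ENNReal.ofReal (2 / b ^ 2) * ENNReal.ofReal ((∫ y in B, u y) ^ 2) := by
        rw [ENNReal.ofReal_add (by positivity) (by positivity), ENNReal.ofReal_mul (by positivity),
          ENNReal.ofReal_mul (by positivity)]
    _ ≤ _ := by
        refine add_le_add ((mul_le_mul_right hI _).trans_eq ?_) le_rfl
        rw [← mul_assoc, ← ENNReal.ofReal_mul (by positivity)]
        congr 2
        rw [hb, Real.rpow_add hr]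
        field_simp

/-- Under such ν constants are integrable, energy bounds for Lebesgue measure persist, and null sets
are unchanged. The density is min(g, 1) for a positive integrable g. -/
theorem exists_finite_measure_le_volume (n : ℕ) :
    ∃ ν : Measure (EuclideanSpace ℝ (Fin n)), IsFiniteMeasure ν ∧ ν ≤ volume ∧ volume ≪ ν := by
  obtain ⟨g, hg0, hg, hgi⟩ := exists_pos_lintegral_lt_of_sigmaFinite
    (volume : Measure (EuclideanSpace ℝ (Fin n))) one_ne_zero
  have hm : Measurable fun x => min (g x : ℝ≥0∞) 1 := hg.coe_nnreal_ennreal.min measurable_const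
  refine ⟨volume.withDensity fun x => min (g x : ℝ≥0∞) 1, ?_, ?_, ?_⟩
  · refine isFiniteMeasure_withDensity (ne_top_of_le_ne_top (hgi.trans ENNReal.one_lt_top).ne ?_)
    exact lintegral_mono fun x => min_le_left _ _
  · conv_rhs => rw [← withDensity_one (μ := (volume : Measure (EuclideanSpace ℝ (Fin n))))]
    exact withDensity_mono (Eventually.of_forall fun x => min_le_right _ _)
  · refine withDensity_absolutelyContinuous' hm.aemeasurable (Eventually.of_forall fun x => ?_)
    exact (lt_min (by exact_mod_cast hg0 x) one_pos).ne'

theorem aestronglyMeasurable_integral_ball {u : EuclideanSpace ℝ (Fin n) → ℝ}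
    (hu : AEStronglyMeasurable u volume) (r : ℝ) :
    AEStronglyMeasurable (fun x => ∫ y in Metric.ball x r, u y) volume := by
  have hs : MeasurableSet {z : EuclideanSpace ℝ (Fin n) × EuclideanSpace ℝ (Fin n) |
      dist z.2 z.1 < r} := measurableSet_lt (measurable_snd.dist measurable_fst) measurable_const
  have h1 : AEStronglyMeasurable ({z : EuclideanSpace ℝ (Fin n) × EuclideanSpace ℝ (Fin n) |
      dist z.2 z.1 < r}.indicator fun z => u z.2) (volume.prod volume) :=
    (hu.comp_quasiMeasurePreserving Measure.quasiMeasurePreserving_snd).indicator hs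
  refine h1.integral_prod_right'.congr (Eventually.of_forall fun x => ?_)
  simp only
  rw [← integral_indicator Metric.isOpen_ball.measurableSet]
  rfl

namespace EnergySpace

variable {hK : IsKernel s K} {hV : IsPotential V}

/-- Integrals over balls are bounded functionals on L², so weak convergence in E passes to them. -/
theorem setIntegral_eq_inner (u : EnergySpace hK hV) (x : EuclideanSpace ℝ (Fin n)) (r : ℝ) :
    ∫ y in Metric.ball x r, u y = inner ℝ (indicatorConstLp 2
      (measurableSet_ball (x := x) (ε := r))
      measure_ball_lt_top.ne (1 : ℝ)) u.toL2 :=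
  (L2.inner_indicatorConstLp_one _ _ _).symm

theorem lintegral_diffK_le (u : EnergySpace hK hV) :
    ∫⁻ z, ‖diffK K u z‖ₑ ^ 2 ≤ ENNReal.ofReal (‖u‖ ^ 2) := by
  have h1 : ∫⁻ z, ‖diffK K u z‖ₑ ^ 2 = ENNReal.ofReal (gagliardo u u) := by
    rw [gagliardo_eq]
    simp only [← sq, enorm_sq_eq_ofReal]
    exact (ofReal_integral_eq_lintegral_ofReal u.memLp_diffK.integrable_sq
      (Eventually.of_forall fun z => sq_nonneg _)).symm
  rw [h1, ← real_inner_self_eq_norm_sq, inner_def]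
  exact ENNReal.ofReal_le_ofReal (le_add_of_nonneg_right (potentialForm_self_nonneg u))

/-- Compactness of the embedding of `E` in `L²_loc`, as almost everywhere convergence of a
subsequence of a weakly null sequence. -/
theorem exists_subseq_ae_tendsto_zero (hs : 0 < s) {w : ℕ → EnergySpace hK hV} {M : ℝ}
    (hM : ∀ m, ‖w m‖ ≤ M) (hw : ∀ v, Tendsto (fun m => inner ℝ (w m) v) atTop (𝓝 0)) :
    ∃ φ : ℕ → ℕ, StrictMono φ ∧ ∀ᵐ x, Tendsto (fun m => w (φ m) x) atTop (𝓝 0) := by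
  obtain ⟨ν, hν, hνle, hνac⟩ := exists_finite_measure_le_volume n
  have hM0 : 0 ≤ M := (norm_nonneg _).trans (hM 0)
  have hνac' : ν ≪ volume := hνle.absolutelyContinuous
  suffices h : Tendsto (fun m => ∫⁻ x, ‖w m x‖ₑ ^ 2 ∂ν) atTop (𝓝 0) by
    have h2 : Tendsto (fun m => eLpNorm (⇑(w m).toL2 - (0 : EuclideanSpace ℝ (Fin n) → ℝ)) 2 ν)
        atTop (𝓝 0) := by
      have := (ENNReal.continuous_rpow_const (y := 1 / 2)).tendsto 0 |>.comp h
      rw [ENNReal.zero_rpow_of_pos (by norm_num)] at this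
      refine this.congr fun m => ?_
      rw [sub_zero, eLpNorm_eq_lintegral_rpow_enorm_toReal (by simp) (by simp)]
      simp
    obtain ⟨φ, hφ, hae⟩ := (tendstoInMeasure_of_tendsto_eLpNorm (by simp)
      (fun m => (Lp.aestronglyMeasurable (w m).toL2).mono_ac hνac')
      aestronglyMeasurable_zero h2).exists_seq_tendsto_ae
    exact ⟨φ, hφ, hνac.ae_le hae⟩
  obtain ⟨C, hC, havg⟩ := hK.exists_enorm_sq_le_average hs
  rw [ENNReal.tendsto_nhds_zero]
  intro ε hε
  obtain ⟨δ, hδ, hδε⟩ : ∃ δ : ℝ, 0 < δ ∧ ENNReal.ofReal δ ≤ ε / 2 := by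
    have h0 : min (ε / 2) 1 ≠ ∞ := ne_top_of_le_ne_top ENNReal.one_ne_top (min_le_right _ _)
    refine ⟨(min (ε / 2) 1).toReal, ENNReal.toReal_pos ?_ h0, ?_⟩
    · exact (lt_min (ENNReal.half_pos hε.ne') one_pos).ne'
    · rw [ENNReal.ofReal_toReal h0]; exact min_le_left _ _
  -- The radius is fixed first, making the energy term at most ε/2 for every m; only then is m taken
  -- large, for the averages.
  obtain ⟨r, hr, hrδ⟩ : ∃ r : ℝ, 0 < r ∧ C * r ^ (2 * s) * M ^ 2 ≤ δ := by
    have hc : ContinuousAt (fun r : ℝ => C * r ^ (2 * s) * M ^ 2) 0 :=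
      (continuousAt_const.mul (continuousAt_id.rpow_const (Or.inr (by positivity)))).mul
        continuousAt_const
    have ht := hc.tendsto.mono_left (nhdsWithin_le_nhds (s := Set.Ioi 0))
    rw [Real.zero_rpow (by positivity), mul_zero, zero_mul] at ht
    obtain ⟨r, h1, h2⟩ := ((ht.eventually_le_const hδ).and eventually_mem_nhdsWithin).exists
    exact ⟨r, h2, h1⟩
  obtain ⟨c, hc, hcu⟩ := havg r hr
  -- Ball integrals tend to 0 at each x by weak convergence, and are bounded uniformly in x and m
  -- because all balls of radius r have the same volume.
  have hA : Tendsto (fun m => ∫⁻ x, ‖∫ y in Metric.ball x r, w m y‖ₑ ^ 2 ∂ν) atTop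
      (𝓝 (∫⁻ _, 0 ∂ν)) := by
    have hpt : ∀ x, Tendsto (fun m => ∫ y in Metric.ball x r, w m y) atTop (𝓝 0) := fun x => by
      let ℓ : EnergySpace hK hV →L[ℝ] ℝ := (innerSL ℝ (indicatorConstLp 2
        (measurableSet_ball (x := x) (ε := r)) measure_ball_lt_top.ne (1 : ℝ))).comp toL2CLM
      refine (hw ((InnerProductSpace.toDual ℝ _).symm ℓ)).congr fun m => ?_
      rw [real_inner_comm, InnerProductSpace.toDual_symm_apply, setIntegral_eq_inner]
      rfl
    refine tendsto_lintegral_of_dominated_convergence' (fun _ => ENNReal.ofReal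
      ((√((volume (Metric.ball (0 : EuclideanSpace ℝ (Fin n)) r)).toReal) * (‖toL2CLM (hK := hK) (hV := hV)‖ * M)) ^ 2))
      (fun m => ?_) (fun m => Eventually.of_forall fun x => ?_) ?_
      (Eventually.of_forall fun x => ?_)
    · exact ((aestronglyMeasurable_integral_ball (Lp.aestronglyMeasurable (w m).toL2)
        r).mono_ac hνac').enorm.pow_const 2
    · change _ ≤ ENNReal.ofReal _
      simp only
      rw [enorm_sq_eq_ofReal, ← sq_abs]
      refine ENNReal.ofReal_le_ofReal (pow_le_pow_left₀ (abs_nonneg _) ?_ 2)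
      rw [setIntegral_eq_inner]
      refine (abs_real_inner_le_norm _ _).trans ?_
      rw [norm_indicatorConstLp (by simp) (by simp), norm_one, one_mul, Measure.real,
        Measure.addHaar_ball_center, Real.sqrt_eq_rpow]
      simp only [ENNReal.toReal_ofNat]
      have h0 : ‖(w m).toL2‖ ≤ ‖toL2CLM (hK := hK) (hV := hV)‖ * M :=
        toL2CLM.le_opNorm_of_le (hM m)
      gcongr
    · rw [lintegral_const]
      exact ENNReal.mul_ne_top ENNReal.ofReal_ne_top (measure_ne_top _ _)
    · have h1 := (continuous_enorm.tendsto (0 : ℝ)).comp (hpt x)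
      have h2 := ((ENNReal.continuous_pow 2).tendsto _).comp h1
      simpa [Function.comp_def] using h2
  rw [lintegral_zero] at hA
  have hA' := ENNReal.Tendsto.const_mul (a := ENNReal.ofReal c) hA (Or.inr ENNReal.ofReal_ne_top)
  rw [mul_zero, ENNReal.tendsto_nhds_zero] at hA'
  filter_upwards [hA' (ε / 2) (ENNReal.half_pos hε.ne')] with m hm
  have hDm : AEMeasurable (fun x => ∫⁻ y, ‖diffK K (w m) (x, y)‖ₑ ^ 2) volume :=
    ((w m).memLp_diffK.1.enorm.pow_const 2).lintegral_prod_right'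
  calc ∫⁻ x, ‖w m x‖ₑ ^ 2 ∂ν
      ≤ ∫⁻ x, (ENNReal.ofReal (C * r ^ (2 * s)) * (∫⁻ y, ‖diffK K (w m) (x, y)‖ₑ ^ 2) +
          ENNReal.ofReal c * ‖∫ y in Metric.ball x r, w m y‖ₑ ^ 2) ∂ν :=
        lintegral_mono fun x => hcu (w m) (Lp.memLp (w m).toL2) x
    _ = ENNReal.ofReal (C * r ^ (2 * s)) * (∫⁻ x, (∫⁻ y, ‖diffK K (w m) (x, y)‖ₑ ^ 2) ∂ν) +
          ENNReal.ofReal c * ∫⁻ x, ‖∫ y in Metric.ball x r, w m y‖ₑ ^ 2 ∂ν := by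
        rw [lintegral_add_left' ((hDm.mono_ac hνac').const_mul _),
          lintegral_const_mul' _ _ ENNReal.ofReal_ne_top,
          lintegral_const_mul' _ _ ENNReal.ofReal_ne_top]
    _ ≤ ε / 2 + ε / 2 := by
        refine add_le_add (le_trans ?_ hδε) hm
        calc ENNReal.ofReal (C * r ^ (2 * s)) * (∫⁻ x, (∫⁻ y, ‖diffK K (w m) (x, y)‖ₑ ^ 2) ∂ν)
            ≤ ENNReal.ofReal (C * r ^ (2 * s)) * ENNReal.ofReal (M ^ 2) := by
              gcongr
              refine (lintegral_mono' hνle le_rfl).trans ?_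
              rw [lintegral_lintegral_diffK (w m).memLp_diffK.1]
              refine (lintegral_diffK_le (w m)).trans (ENNReal.ofReal_le_ofReal ?_)
              exact pow_le_pow_left₀ (norm_nonneg _) (hM m) 2
          _ ≤ ENNReal.ofReal δ := by
              rw [← ENNReal.ofReal_mul (by positivity)]
              exact ENNReal.ofReal_le_ofReal hrδ
    _ = ε := ENNReal.add_halves ε

end EnergySpace

end

/-! ### Integrals that vanish in the limit -/

section

open scoped ENNReal

section VanishingIntegrals

variable {X : Type*} [MeasurableSpace X] {μ : Measure X}

/-- A variant of `tendsto_lintegral_zero_of_le_add` where E need only be small uniformly in m, and E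
and B may depend on ε. -/
theorem tendsto_lintegral_zero_of_forall_le_add {F : ℕ → X → ℝ≥0∞}
    (hF : ∀ m, AEMeasurable (F m) μ) (hF0 : ∀ᵐ x ∂μ, Tendsto (fun m => F m x) atTop (𝓝 0))
    (h : ∀ ε : ℝ≥0∞, 0 < ε → ∃ (E : ℕ → X → ℝ≥0∞) (B : X → ℝ≥0∞), (∀ m, AEMeasurable (E m) μ) ∧
      (∀ m x, F m x ≤ E m x + B x) ∧ ∫⁻ x, B x ∂μ ≠ ∞ ∧ ∀ m, ∫⁻ x, E m x ∂μ ≤ ε) :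
    Tendsto (fun m => ∫⁻ x, F m x ∂μ) atTop (𝓝 0) := by
  rw [ENNReal.tendsto_nhds_zero]
  intro ε hε
  obtain ⟨E, B, hE, hle, hB, hEε⟩ := h (ε / 2) (ENNReal.half_pos hε.ne')
  have h1 : Tendsto (fun m => ∫⁻ x, (F m x - E m x) ∂μ) atTop (𝓝 (∫⁻ _, 0 ∂μ)) := by
    refine tendsto_lintegral_of_dominated_convergence' B (fun m => (hF m).sub (hE m))
      (fun m => Eventually.of_forall fun x => tsub_le_iff_left.2 (hle m x)) hB ?_
    filter_upwards [hF0] with x hx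
    exact tendsto_of_tendsto_of_tendsto_of_le_of_le tendsto_const_nhds hx
      (fun m => zero_le) (fun m => tsub_le_self)
  rw [lintegral_zero, ENNReal.tendsto_nhds_zero] at h1
  filter_upwards [h1 (ε / 2) (ENNReal.half_pos hε.ne')] with m hm
  calc ∫⁻ x, F m x ∂μ ≤ ∫⁻ x, (F m x - E m x + E m x) ∂μ := lintegral_mono fun x => le_tsub_add
    _ = ∫⁻ x, (F m x - E m x) ∂μ + ∫⁻ x, E m x ∂μ := lintegral_add_right' _ (hE m)
    _ ≤ ε / 2 + ε / 2 := add_le_add hm (hEε m)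
    _ = ε := ENNReal.add_halves ε

theorem exists_pos_ofReal_mul_le {φ : ℝ → ℝ} (hφ : Tendsto φ (𝓝[>] 0) (𝓝 0)) (M : ℝ)
    {ε : ℝ≥0∞} (hε : 0 < ε) :
    ∃ δ : ℝ, 0 < δ ∧ ENNReal.ofReal (φ δ) * ENNReal.ofReal M ≤ ε := by
  have h1 := ENNReal.Tendsto.mul_const (b := ENNReal.ofReal M)
    ((ENNReal.continuous_ofReal.tendsto 0).comp hφ) (Or.inr ENNReal.ofReal_ne_top)
  rw [ENNReal.ofReal_zero, zero_mul, ENNReal.tendsto_nhds_zero] at h1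
  obtain ⟨δ, h2, h3⟩ := ((h1 ε hε).and eventually_mem_nhdsWithin).exists
  exact ⟨δ, h3, h2⟩

/-- Young's inequality |w|^{p-1}|z| ≤ δ^{p-1}|z|^p + δ⁻¹|w|^p, by comparing |w| with δ|z|: the first
term is uniformly small, the second fixed and integrable. -/
theorem tendsto_lintegral_rpow_mul {p M : ℝ} (hp : 1 < p) {w : X → ℝ} {z : ℕ → X → ℝ}
    (hw : MemLp w (ENNReal.ofReal p) μ) (hz : ∀ m, AEStronglyMeasurable (z m) μ)
    (hz0 : ∀ᵐ x ∂μ, Tendsto (fun m => z m x) atTop (𝓝 0))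
    (hM : ∀ m, ∫⁻ x, ENNReal.ofReal (|z m x| ^ p) ∂μ ≤ ENNReal.ofReal M) :
    Tendsto (fun m => ∫⁻ x, ENNReal.ofReal (|w x| ^ (p - 1) * |z m x|) ∂μ) atTop (𝓝 0) := by
  have hza : ∀ m, AEMeasurable (fun x => |z m x|) μ := fun m => (hz m).aemeasurable.abs
  refine tendsto_lintegral_zero_of_forall_le_add
    (fun m => ((hw.1.aemeasurable.abs.pow_const _).mul (hza m)).ennreal_ofReal) ?_
    fun ε hε => ?_
  · filter_upwards [hz0] with x hx
    have := ENNReal.continuous_ofReal.tendsto _ |>.comp ((hx.abs).const_mul (|w x| ^ (p - 1)))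
    simpa [Function.comp_def] using this
  have hφ : Tendsto (fun δ : ℝ => δ ^ (p - 1)) (𝓝[>] 0) (𝓝 0) := by
    have hc : ContinuousAt (fun δ : ℝ => δ ^ (p - 1)) 0 :=
      continuousAt_id.rpow_const (Or.inr (by linarith))
    have := hc.tendsto.mono_left (nhdsWithin_le_nhds (s := Set.Ioi 0))
    rwa [Real.zero_rpow (by linarith)] at this
  obtain ⟨δ, hδ, hδε⟩ := exists_pos_ofReal_mul_le hφ M hε
  refine ⟨fun m x => ENNReal.ofReal (δ ^ (p - 1)) * ENNReal.ofReal (|z m x| ^ p),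
    fun x => ENNReal.ofReal (δ⁻¹ * |w x| ^ p),
    fun m => ((hza m).pow_const _).ennreal_ofReal.const_mul _, fun m x => ?_, ?_, fun m => ?_⟩
  · beta_reduce
    rw [← ENNReal.ofReal_mul (by positivity), ← ENNReal.ofReal_add (by positivity) (by positivity)]
    refine ENNReal.ofReal_le_ofReal ?_
    have hpow : ∀ a : ℝ, 0 ≤ a → a ^ (p - 1) * a = a ^ p := fun a ha => by
      rcases ha.eq_or_lt with rfl | h
      · rw [mul_zero, Real.zero_rpow (by linarith)]
      · rw [← Real.rpow_add_one h.ne', sub_add_cancel]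
    rcases le_total |w x| (δ * |z m x|) with h | h
    · have : |w x| ^ (p - 1) * |z m x| ≤ δ ^ (p - 1) * |z m x| ^ p := by
        rw [← hpow _ (abs_nonneg (z m x)), ← mul_assoc,
          ← Real.mul_rpow hδ.le (abs_nonneg (z m x))]
        gcongr
      have : 0 ≤ δ⁻¹ * |w x| ^ p := by positivity
      linarith
    · have : |w x| ^ (p - 1) * |z m x| ≤ δ⁻¹ * |w x| ^ p := by
        rw [← hpow _ (abs_nonneg (w x)), mul_left_comm]
        gcongr
        rwa [← div_eq_inv_mul, le_div_iff₀' hδ]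
      have : 0 ≤ δ ^ (p - 1) * |z m x| ^ p := by positivity
      linarith
  · exact ((IsPowerCaratheodory.integrable_abs_rpow hp hw).const_mul _).lintegral_lt_top.ne
  · rw [lintegral_const_mul' _ _ ENNReal.ofReal_ne_top]
    exact (mul_le_mul_right (hM m) _).trans hδε

/-- Comparing |z| with δ⁻¹ gives |z|^p ≤ δ^{q-p}|z|^q + δ^{-p}; the constant is integrable as the
measure is finite. -/
theorem tendsto_lintegral_rpow_of_bounded [IsFiniteMeasure μ] {p q M : ℝ} (hp : 0 < p)
    (hpq : p < q) {z : ℕ → X → ℝ} (hz : ∀ m, AEStronglyMeasurable (z m) μ)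
    (hz0 : ∀ᵐ x ∂μ, Tendsto (fun m => z m x) atTop (𝓝 0))
    (hM : ∀ m, ∫⁻ x, ENNReal.ofReal (|z m x| ^ q) ∂μ ≤ ENNReal.ofReal M) :
    Tendsto (fun m => ∫⁻ x, ENNReal.ofReal (|z m x| ^ p) ∂μ) atTop (𝓝 0) := by
  have hza : ∀ m, AEMeasurable (fun x => |z m x|) μ := fun m => (hz m).aemeasurable.abs
  refine tendsto_lintegral_zero_of_forall_le_add
    (fun m => ((hza m).pow_const _).ennreal_ofReal) ?_ fun ε hε => ?_
  · filter_upwards [hz0] with x hx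
    have h1 : Tendsto (fun m => |z m x| ^ p) atTop (𝓝 (|(0 : ℝ)| ^ p)) :=
      hx.abs.rpow_const (Or.inr hp.le)
    have := ENNReal.continuous_ofReal.tendsto _ |>.comp h1
    simpa [Function.comp_def, Real.zero_rpow hp.ne'] using this
  have hφ : Tendsto (fun δ : ℝ => δ ^ (q - p)) (𝓝[>] 0) (𝓝 0) := by
    have hc : ContinuousAt (fun δ : ℝ => δ ^ (q - p)) 0 :=
      continuousAt_id.rpow_const (Or.inr (by linarith))
    have := hc.tendsto.mono_left (nhdsWithin_le_nhds (s := Set.Ioi 0))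
    rwa [Real.zero_rpow (by linarith)] at this
  obtain ⟨δ, hδ, hδε⟩ := exists_pos_ofReal_mul_le hφ M hε
  refine ⟨fun m x => ENNReal.ofReal (δ ^ (q - p)) * ENNReal.ofReal (|z m x| ^ q),
    fun _ => ENNReal.ofReal (δ⁻¹ ^ p),
    fun m => ((hza m).pow_const _).ennreal_ofReal.const_mul _, fun m x => ?_, ?_, fun m => ?_⟩
  · beta_reduce
    rw [← ENNReal.ofReal_mul (by positivity), ← ENNReal.ofReal_add (by positivity) (by positivity)]
    refine ENNReal.ofReal_le_ofReal ?_
    rcases le_total |z m x| δ⁻¹ with h | h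
    · have h1 : |z m x| ^ p ≤ δ⁻¹ ^ p := by gcongr
      have : 0 ≤ δ ^ (q - p) * |z m x| ^ q := by positivity
      linarith
    · have hz1 : 1 ≤ δ * |z m x| := by
        rwa [inv_eq_one_div, div_le_iff₀' hδ] at h
      have hzp : 0 < |z m x| := (inv_pos.2 hδ).trans_le h
      have h1 : |z m x| ^ p ≤ δ ^ (q - p) * |z m x| ^ q := by
        have h2 : |z m x| ^ q = |z m x| ^ (q - p) * |z m x| ^ p := by
          rw [← Real.rpow_add hzp, sub_add_cancel]
        rw [h2, ← mul_assoc, ← Real.mul_rpow hδ.le hzp.le]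
        exact le_mul_of_one_le_left (by positivity) (Real.one_le_rpow hz1 (by linarith))
      have : 0 ≤ δ⁻¹ ^ p := by positivity
      linarith
  · rw [lintegral_const]
    exact ENNReal.mul_ne_top ENNReal.ofReal_ne_top (measure_ne_top _ _)
  · rw [lintegral_const_mul' _ _ ENNReal.ofReal_ne_top]
    exact (mul_le_mul_right (hM m) _).trans hδε

/-- Passing to the positive part means that one-sided bounds on the integrand suffice in the
Palais–Smale argument. -/
theorem integral_le_toReal_lintegral {f : X → ℝ} (hf : Integrable f μ) :
    ∫ x, f x ∂μ ≤ (∫⁻ x, ENNReal.ofReal (f x) ∂μ).toReal := by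
  rw [integral_eq_lintegral_pos_part_sub_lintegral_neg_part hf]
  exact sub_le_self _ ENNReal.toReal_nonneg

theorem lintegral_abs_rpow_le {P : ℝ≥0∞} [Fact (1 ≤ P)] {p M : ℝ} (hp : 0 < p)
    (hP : P = ENNReal.ofReal p) {g : Lp ℝ P μ} (hg : ‖g‖ ≤ M) :
    ∫⁻ x, ENNReal.ofReal (|g x| ^ p) ∂μ ≤ ENNReal.ofReal (M ^ p) := by
  subst hP
  have hM : 0 ≤ M := (norm_nonneg g).trans hg
  have h1 : eLpNorm g (ENNReal.ofReal p) μ ≤ ENNReal.ofReal M := by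
    rw [← Lp.enorm_def, ← ofReal_norm]
    exact ENNReal.ofReal_le_ofReal hg
  rw [eLpNorm_eq_lintegral_rpow_enorm_toReal (by simp; linarith) ENNReal.ofReal_ne_top,
    ENNReal.toReal_ofReal hp.le, one_div, ENNReal.rpow_inv_le_iff hp,
    ENNReal.ofReal_rpow_of_nonneg hM hp.le] at h1
  refine (lintegral_congr fun x => ?_).trans_le h1
  rw [← ENNReal.ofReal_rpow_of_nonneg (abs_nonneg _) hp.le, Real.enorm_eq_ofReal_abs]

end VanishingIntegrals

end

/-! ### Superquadraticity and growth of the penalized nonlinearity -/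

section

open scoped ENNReal

variable {n : ℕ} {s p θ R : ℝ} {K V : EuclideanSpace ℝ (Fin n) → ℝ} {f : ℝ → ℝ}

section Superquadratic

theorem IsNonlinearity.primitive_le (hf : IsNonlinearity p θ f) (hp : 2 < p) (hθ : 2 < θ) (t : ℝ) :
    primitive f t ≤ 1 / θ * (f t * t) := by
  have hθ0 : 0 < θ := by linarith
  rcases le_or_gt t 0 with h | h
  · have h0 : ∀ τ, τ ≤ 0 → f τ = 0 := fun τ hτ => by
      rcases hτ.lt_or_eq with h | rfl
      · exact hf.zero τ h
      · exact hf.apply_zero hp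
    have : primitive f t = 0 := by
      unfold primitive
      refine (intervalIntegral.integral_congr (g := fun _ => 0) fun τ hτ => ?_).trans (by simp)
      rw [Set.uIcc_of_ge h] at hτ
      exact h0 τ hτ.2
    rw [this, h0 t h]; simp
  · have := hf.superquadratic t h
    rw [one_div, ← div_eq_inv_mul, le_div_iff₀ hθ0]
    linarith

theorem continuous_truncated (hf : IsNonlinearity p θ f) (hθ : 2 < θ) (v : ℝ) :
    Continuous (truncated θ f v) := by
  have : truncated θ f v = fun t => min (f t) (v / (2 * θ / (θ - 2)) * t) :=
    funext fun t => truncated_eq_min hθ v t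
  rw [this]
  exact hf.continuous.min (continuous_const.mul continuous_id)

theorem primitive_truncated_le (hf : IsNonlinearity p θ f) (hp : 2 < p) (hθ : 2 < θ) {v : ℝ}
    (hv : 0 ≤ v) (t : ℝ) :
    primitive (truncated θ f v) t ≤ v / (2 * θ / (θ - 2)) * (t ^ 2 / 2) := by
  have hle := abs_truncated_le hf hp hθ hv
  have hc := continuous_truncated hf hθ v
  have hl : Continuous fun τ : ℝ => v / (2 * θ / (θ - 2)) * τ := continuous_const.mul continuous_id
  have hi : ∫ τ in (0 : ℝ)..t, v / (2 * θ / (θ - 2)) * τ = v / (2 * θ / (θ - 2)) * (t ^ 2 / 2) := by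
    rw [intervalIntegral.integral_const_mul, integral_id]
    ring
  rw [← hi]
  unfold primitive
  rcases le_total 0 t with h | h
  · refine intervalIntegral.integral_mono_on h (hc.intervalIntegrable _ _)
      (hl.intervalIntegrable _ _) fun τ hτ => ?_
    rw [← abs_of_nonneg hτ.1]
    have := hle τ
    rw [abs_of_nonneg hτ.1] at this ⊢
    exact (le_abs_self _).trans this
  · rw [intervalIntegral.integral_symm t 0, intervalIntegral.integral_symm t 0, neg_le_neg_iff]
    refine intervalIntegral.integral_mono_on h (hl.intervalIntegrable _ _)
      (hc.intervalIntegrable _ _) fun τ hτ => ?_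
    have := (abs_le.1 (hle τ)).1
    rwa [abs_of_nonpos hτ.2, mul_neg, neg_neg] at this

theorem truncated_mul_self_nonneg (hf : IsNonlinearity p θ f) (hp : 2 < p) (hθ : 2 < θ) {v : ℝ}
    (hv : 0 ≤ v) (t : ℝ) : 0 ≤ truncated θ f v t * t := by
  have hk : 0 < 2 * θ / (θ - 2) := div_pos (by linarith) (by linarith)
  have hvk : 0 ≤ v / (2 * θ / (θ - 2)) := by positivity
  rw [truncated_eq_min hθ]
  rcases le_total 0 t with h | h
  · exact mul_nonneg (le_min (hf.nonneg hp t) (by positivity)) h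
  · exact mul_nonneg_of_nonpos_of_nonpos
      ((min_le_right _ _).trans (mul_nonpos_of_nonneg_of_nonpos hvk h)) h

/-- The superquadraticity condition satisfied by the penalized nonlinearity. -/
theorem primitive_penalized_sub_le (hf : IsNonlinearity p θ f) (hp : 2 < p) (hθ : 2 < θ)
    (hV : IsPotential V) (x : EuclideanSpace ℝ (Fin n)) (t : ℝ) :
    primitive (penalized θ R f V x) t - 1 / θ * (penalized θ R f V x t * t) ≤
      (θ - 2) / (4 * θ) * (V x * t ^ 2) := by
  obtain ⟨V₀, h0, hV0⟩ := hV.lower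
  have hv : 0 ≤ V x := (h0.trans_le (hV0 x)).le
  have hθ0 : 0 < θ := by linarith
  have hθ2 : 0 < θ - 2 := by linarith
  have hr : 0 ≤ (θ - 2) / (4 * θ) * (V x * t ^ 2) := by positivity
  by_cases hx : ‖x‖ ≤ R
  · have e : penalized θ R f V x = f := by funext t; simp [penalized, hx]
    rw [e]
    linarith [hf.primitive_le hp hθ t]
  · have e : penalized θ R f V x = truncated θ f (V x) := by funext t; simp [penalized, hx]
    rw [e]
    have h1 := primitive_truncated_le hf hp hθ hv t
    have h2 : 0 ≤ 1 / θ * (truncated θ f (V x) t * t) :=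
      mul_nonneg (by positivity) (truncated_mul_self_nonneg hf hp hθ hv t)
    have h3 : V x / (2 * θ / (θ - 2)) * (t ^ 2 / 2) = (θ - 2) / (4 * θ) * (V x * t ^ 2) := by
      field_simp
      ring
    linarith

end Superquadratic

variable {hK : IsKernel s K} {hV : IsPotential V}

open EnergySpace

theorem EnergySpace.integral_potential_le (u : EnergySpace hK hV) :
    ∫ x, V x * u x ^ 2 ≤ ‖u‖ ^ 2 := by
  rw [norm_sq_eq]
  refine le_add_of_nonneg_left (integral_nonneg fun z => ?_)
  exact mul_nonneg (sq_nonneg _) (hK.pos _).le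

/-- The coefficient 1/2 - 1/θ equals 1/k = (θ-2)/(2θ). The penalization consumes at most V t²/(2k),
half of this after ∫ V u² ≤ ‖u‖², and the other half remains. -/
theorem norm_sq_le_penalizedEnergy_sub (hf : IsNonlinearity p θ f) (hp : 2 < p) (hθ : 2 < θ)
    (hm : ∀ u : EnergySpace hK hV, MemLp u (ENNReal.ofReal p) volume) (u : EnergySpace hK hV) :
    (θ - 2) / (4 * θ) * ‖u‖ ^ 2 ≤ penalizedEnergy θ R f hK hV u -
      1 / θ * (inner ℝ u u - ∫ x, penalized θ R f V x (u x) * u x) := by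
  have hG := integrable_primitive_penalized (R := R) hf hp hθ (hm u)
  have hg := integrable_penalized_mul (R := R) hf hp hθ (hm u) (hm u)
  have hVu : Integrable (fun x => V x * u x ^ 2) volume := u.2.2
  have h1 : (∫ x, primitive (penalized θ R f V x) (u x)) -
      1 / θ * (∫ x, penalized θ R f V x (u x) * u x) ≤
      (θ - 2) / (4 * θ) * ∫ x, V x * u x ^ 2 := by
    rw [← integral_const_mul, ← integral_const_mul, ← integral_sub hG (hg.const_mul _)]
    exact integral_mono (hG.sub (hg.const_mul _)) (hVu.const_mul _)
      fun x => primitive_penalized_sub_le hf hp hθ hV x (u x)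
  have hθ0 : 0 < θ := by linarith
  have hθ2 : 0 < θ - 2 := by linarith
  have h2 : (θ - 2) / (4 * θ) * (∫ x, V x * u x ^ 2) ≤ (θ - 2) / (4 * θ) * ‖u‖ ^ 2 :=
    mul_le_mul_of_nonneg_left u.integral_potential_le (by positivity)
  have h3 : (1 / 2 - 1 / θ) * ‖u‖ ^ 2 = 2 * ((θ - 2) / (4 * θ) * ‖u‖ ^ 2) := by
    field_simp; ring
  rw [real_inner_self_eq_norm_sq]
  unfold penalizedEnergy
  linarith

/-- The subtracted term is V z²/k, the part later absorbed by the norm. On the right, the first term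
lives on a bounded set and the other two pair z with w, which will be fixed. -/
theorem penalized_mul_le (hf : IsNonlinearity p θ f) (hp : 2 < p) (hθ : 2 < θ)
    (hV : IsPotential V) :
    ∃ c : ℝ, 0 < c ∧ ∀ (x : EuclideanSpace ℝ (Fin n)) (z w : ℝ),
      penalized θ R f V x (z + w) * z - (θ - 2) / (2 * θ) * (V x * z ^ 2) ≤
        c * (Metric.closedBall 0 R).indicator (fun _ => |z| ^ p) x + c * (|w| ^ (p - 1) * |z|) +
          |√(V x) * w| ^ ((2 : ℝ) - 1) * |√(V x) * z| := by
  obtain ⟨V₀, h0, hV0⟩ := hV.lower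
  obtain ⟨c₀, hc₀, hg⟩ := hf.growth
  have hθ0 : 0 < θ := by linarith
  have hθ2 : 0 < θ - 2 := by linarith
  have hp1 : 0 ≤ p - 1 := by linarith
  -- The factor comes from |z + w| ≤ 2 max(|z|, |w|).
  refine ⟨c₀ * 2 ^ (p - 1), by positivity, fun x z w => ?_⟩
  have hv : 0 < V x := h0.trans_le (hV0 x)
  -- The exponent is written 2 - 1 to match `tendsto_lintegral_rpow_mul` with p = 2, applied to √V w
  -- and √V z.
  have hT3 : |√(V x) * w| ^ ((2 : ℝ) - 1) * |√(V x) * z| = V x * (|w| * |z|) := by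
    norm_num [abs_mul, abs_of_nonneg (Real.sqrt_nonneg _)]
    linear_combination |w| * |z| * Real.mul_self_sqrt hv.le
  rw [hT3]
  have hT3' : 0 ≤ V x * (|w| * |z|) := by positivity
  have hT2' : 0 ≤ c₀ * 2 ^ (p - 1) * (|w| ^ (p - 1) * |z|) := by positivity
  have hq' : 0 ≤ (θ - 2) / (2 * θ) * (V x * z ^ 2) := by positivity
  by_cases hx : ‖x‖ ≤ R
  · have e : penalized θ R f V x (z + w) = f (z + w) := by simp [penalized, hx]
    rw [e, Set.indicator_of_mem (by simpa using hx)]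
    have h1 : |z + w| ^ (p - 1) ≤ 2 ^ (p - 1) * (|z| ^ (p - 1) + |w| ^ (p - 1)) := by
      have h2 : |z + w| ≤ 2 * max |z| |w| := by
        linarith [abs_add_le z w, le_max_left |z| |w|, le_max_right |z| |w|]
      have h3 : (max |z| |w|) ^ (p - 1) ≤ |z| ^ (p - 1) + |w| ^ (p - 1) := by
        rcases max_choice |z| |w| with h | h <;> rw [h]
        · exact le_add_of_nonneg_right (by positivity)
        · exact le_add_of_nonneg_left (by positivity)
      calc |z + w| ^ (p - 1) ≤ (2 * max |z| |w|) ^ (p - 1) := by gcongr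
        _ = 2 ^ (p - 1) * (max |z| |w|) ^ (p - 1) := Real.mul_rpow (by norm_num) (by positivity)
        _ ≤ _ := by gcongr
    have hpow : |z| ^ p = |z| ^ (p - 1) * |z| := by
      rcases (abs_nonneg z).eq_or_lt with h | h
      · rw [← h, mul_zero, Real.zero_rpow (by linarith)]
      · rw [← Real.rpow_add_one h.ne', sub_add_cancel]
    have h4 : f (z + w) * z ≤
        c₀ * (2 ^ (p - 1) * (|z| ^ (p - 1) + |w| ^ (p - 1))) * |z| := by
      refine (le_abs_self _).trans ?_
      rw [abs_mul]
      gcongr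
      exact (hg _).trans (by gcongr)
    rw [hpow]
    nlinarith [h4]
  · have e : penalized θ R f V x (z + w) = truncated θ f (V x) (z + w) := by simp [penalized, hx]
    rw [e, Set.indicator_of_notMem (by simpa using hx), mul_zero, zero_add]
    have h1 : truncated θ f (V x) (z + w) * z ≤ V x / (2 * θ / (θ - 2)) * (|z| + |w|) * |z| := by
      refine (le_abs_self _).trans ?_
      rw [abs_mul]
      gcongr
      refine (abs_truncated_le hf hp hθ hv.le _).trans ?_
      gcongr
      exact abs_add_le _ _
    have h2 : V x / (2 * θ / (θ - 2)) * (|z| + |w|) * |z| =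
        (θ - 2) / (2 * θ) * (V x * z ^ 2) + (θ - 2) / (2 * θ) * (V x * (|w| * |z|)) := by
      rw [← sq_abs z]
      field_simp
    have h3 : (θ - 2) / (2 * θ) ≤ 1 := by rw [div_le_one (by linarith)]; linarith
    have h4 := mul_le_mul_of_nonneg_right h3 hT3'
    linarith

end

/-! ### The Palais–Smale condition -/

section

open scoped ENNReal

variable {n : ℕ} {s p θ R : ℝ} {K V : EuclideanSpace ℝ (Fin n) → ℝ} {f : ℝ → ℝ}
  {hK : IsKernel s K} {hV : IsPotential V}

open EnergySpace

theorem tendsto_lintegral_penalized (hs : 0 < s) (hn : 2 * s < (n : ℝ)) (hp : 2 < p)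
    (hp' : p < 2 * (n : ℝ) / ((n : ℝ) - 2 * s)) (hθ : 2 < θ) (hf : IsNonlinearity p θ f)
    {z : ℕ → EnergySpace hK hV} (w : EnergySpace hK hV) {M : ℝ} (hM : ∀ m, ‖z m‖ ≤ M)
    (hz0 : ∀ᵐ x, Tendsto (fun m => z m x) atTop (𝓝 0)) :
    Tendsto (fun m => ∫⁻ x, ENNReal.ofReal (penalized θ R f V x (z m x + w x) * z m x -
      (θ - 2) / (2 * θ) * (V x * z m x ^ 2))) atTop (𝓝 0) := by
  set q := 2 * (n : ℝ) / ((n : ℝ) - 2 * s) with hq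
  have hmp : ∀ u : EnergySpace hK hV, MemLp u (ENNReal.ofReal p) volume :=
    memLp_of_le hs hn hp.le hp'.le
  have hmq : ∀ u : EnergySpace hK hV, MemLp u (ENNReal.ofReal q) volume :=
    memLp_of_le hs hn (hp.trans hp').le le_rfl
  have : Fact (1 ≤ ENNReal.ofReal p) := ⟨by simp; linarith⟩
  have : Fact (1 ≤ ENNReal.ofReal q) := ⟨by simp; linarith⟩
  have hzm : ∀ m, AEStronglyMeasurable (z m) volume := fun m => Lp.aestronglyMeasurable (z m).toL2
  have hVz : ∀ m, AEStronglyMeasurable (fun x => √(V x) * z m x) volume :=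
    fun m => (z m).memLp_potential.1
  have hbound : ∀ {r : ℝ} [Fact (1 ≤ ENNReal.ofReal r)], 0 < r →
      ∀ hmr : ∀ u : EnergySpace hK hV, MemLp u (ENNReal.ofReal r) volume, ∀ m,
      ∫⁻ x, ENNReal.ofReal (|z m x| ^ r) ≤
        ENNReal.ofReal ((‖inclusion hmr‖ * M) ^ r) := fun hr hmr m => by
    refine (lintegral_congr_ae ?_).trans_le
      (lintegral_abs_rpow_le hr rfl ((inclusion hmr).le_opNorm_of_le (hM m)))
    filter_upwards [coeFn_inclusion hmr (z m)] with x hx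
    rw [hx]
  have hboundV : ∀ m, ∫⁻ x, ENNReal.ofReal (|√(V x) * z m x| ^ (2 : ℝ)) ≤
      ENNReal.ofReal (M ^ (2 : ℝ)) := fun m => by
    refine (lintegral_congr_ae ?_).trans_le
      (lintegral_abs_rpow_le two_pos (by simp) ((norm_potLin_le (z m)).trans (hM m)))
    filter_upwards [coeFn_potLin (z m)] with x hx
    rw [hx]
  have hfin : IsFiniteMeasure (volume.restrict
      (Metric.closedBall (0 : EuclideanSpace ℝ (Fin n)) R)) := ⟨by
    rw [Measure.restrict_apply_univ]; exact measure_closedBall_lt_top⟩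
  -- The only use of p < 2* as a strict inequality: on the ball, a bound in L^{2*} and almost
  -- everywhere convergence give convergence in L^p.
  have T1 := tendsto_lintegral_rpow_of_bounded (by linarith) hp' (fun m => (hzm m).restrict)
    (ae_restrict_of_ae hz0) (fun m => (setLIntegral_le_lintegral
      (Metric.closedBall (0 : EuclideanSpace ℝ (Fin n)) R) _).trans
      (hbound (by linarith) hmq m))
  have T2 := tendsto_lintegral_rpow_mul (by linarith) (hmp w) hzm hz0
    (hbound (by linarith) hmp)
  have T3 := tendsto_lintegral_rpow_mul one_lt_two w.memLp_potential' hVz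
    (hz0.mono fun x hx => by simpa using hx.const_mul (√(V x))) hboundV
  obtain ⟨c, hc, hle⟩ := penalized_mul_le (R := R) hf hp hθ hV
  have hsum := ((ENNReal.Tendsto.const_mul (a := ENNReal.ofReal c) T1
    (Or.inr ENNReal.ofReal_ne_top)).add (ENNReal.Tendsto.const_mul (a := ENNReal.ofReal c) T2
    (Or.inr ENNReal.ofReal_ne_top))).add T3
  simp only [mul_zero, add_zero] at hsum
  refine tendsto_of_tendsto_of_tendsto_of_le_of_le tendsto_const_nhds hsum
    (fun m => zero_le) (fun m => ?_)
  have hza : AEMeasurable (fun x => |z m x|) volume := (hzm m).aemeasurable.abs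
  have hT3 : AEMeasurable (fun x => ENNReal.ofReal
      (|√(V x) * w x| ^ ((2 : ℝ) - 1) * |√(V x) * z m x|)) volume :=
    ((w.memLp_potential.1.aemeasurable.abs.pow_const _).mul
      (hVz m).aemeasurable.abs).ennreal_ofReal
  beta_reduce
  rw [← lintegral_indicator measurableSet_closedBall,
    ← lintegral_const_mul' _ _ ENNReal.ofReal_ne_top,
    ← lintegral_const_mul' _ _ ENNReal.ofReal_ne_top,
    ← lintegral_add_left' (((hza.pow_const p).ennreal_ofReal.indicator
      measurableSet_closedBall).const_mul _),
    ← lintegral_add_right' _ hT3]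
  refine lintegral_mono fun x => ?_
  refine (ENNReal.ofReal_le_ofReal (hle x (z m x) (w x))).trans ?_
  have hind : 0 ≤ (Metric.closedBall 0 R).indicator (fun _ => |z m x| ^ p) x :=
    Set.indicator_nonneg (fun _ _ => by positivity) _
  rw [ENNReal.ofReal_add (by positivity) (by positivity),
    ENNReal.ofReal_add (by positivity) (by positivity), ENNReal.ofReal_mul hc.le,
    ENNReal.ofReal_mul hc.le]
  refine add_le_add (add_le_add (mul_le_mul_right (le_of_eq ?_) _) le_rfl) le_rfl
  by_cases hx : x ∈ Metric.closedBall (0 : EuclideanSpace ℝ (Fin n)) R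
  · rw [Set.indicator_of_mem hx, Set.indicator_of_mem hx]
  · rw [Set.indicator_of_notMem hx, Set.indicator_of_notMem hx, ENNReal.ofReal_zero]

/-- In A(z + w) z = ‖z‖² + ⟨w, z⟩ - ∫ g(x, z + w) z, the left side and ⟨w, z⟩ tend to 0, and the
last integral is at most κ ∫ V z² + o(1) with κ = 1/k ≤ 1/2. Hence ‖z‖²/2 is at most o(1). -/
theorem tendsto_zero_of_ae_tendsto_zero (hs : 0 < s) (hn : 2 * s < (n : ℝ)) (hp : 2 < p)
    (hp' : p < 2 * (n : ℝ) / ((n : ℝ) - 2 * s)) (hθ : 2 < θ) (hf : IsNonlinearity p θ f)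
    {A : EnergySpace hK hV → EnergySpace hK hV →L[ℝ] ℝ}
    (hA : ∀ u v, A u v = inner ℝ u v - ∫ x, penalized θ R f V x (u x) * v x)
    {z : ℕ → EnergySpace hK hV} (w : EnergySpace hK hV) {M : ℝ} (hM : ∀ m, ‖z m‖ ≤ M)
    (hz0 : ∀ᵐ x, Tendsto (fun m => z m x) atTop (𝓝 0))
    (hzw : Tendsto (fun m => inner ℝ (z m) w) atTop (𝓝 0))
    (hAz : Tendsto (fun m => ‖A (z m + w)‖) atTop (𝓝 0)) :
    Tendsto z atTop (𝓝 0) := by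
  have hθ0 : 0 < θ := by linarith
  have hmp : ∀ u : EnergySpace hK hV, MemLp u (ENNReal.ofReal p) volume :=
    memLp_of_le hs hn hp.le hp'.le
  set κ := (θ - 2) / (2 * θ) with hκ
  have hκ1 : κ ≤ 1 / 2 := by
    rw [hκ, div_le_div_iff₀ (by positivity) two_pos]; linarith
  have hκ0 : 0 ≤ κ := div_nonneg (by linarith) (by positivity)
  have hlim := (ENNReal.tendsto_toReal ENNReal.zero_ne_top).comp
    (tendsto_lintegral_penalized (R := R) hs hn hp hp' hθ hf w hM hz0)
  have hAz' : Tendsto (fun m => ‖A (z m + w)‖ * M) atTop (𝓝 0) := by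
    simpa using hAz.mul_const M
  have hsum := (hAz'.sub hzw).add hlim
  simp only [ENNReal.toReal_zero, sub_zero, add_zero] at hsum
  have key : ∀ m, 1 / 2 * ‖z m‖ ^ 2 ≤ ‖A (z m + w)‖ * M - inner ℝ (z m) w +
      (∫⁻ x, ENNReal.ofReal (penalized θ R f V x (z m x + w x) * z m x -
        κ * (V x * z m x ^ 2))).toReal := fun m => by
    have hcoe : (fun x => penalized θ R f V x ((z m + w) x) * z m x) =ᵐ[volume]
        fun x => penalized θ R f V x (z m x + w x) * z m x := by
      filter_upwards [coe_add (z m) w] with x hx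
      rw [hx, Pi.add_apply]
    have hg := (integrable_penalized_mul (R := R) hf hp hθ (hmp (z m + w)) (hmp (z m))).congr hcoe
    have hVz : Integrable (fun x => V x * z m x ^ 2) volume := (z m).2.2
    have h1 := integral_le_toReal_lintegral (hg.sub (hVz.const_mul κ))
    simp only [Pi.sub_apply] at h1
    rw [integral_sub hg (hVz.const_mul κ), integral_const_mul] at h1
    have h2 := hA (z m + w) (z m)
    rw [integral_congr_ae hcoe, inner_add_left, real_inner_self_eq_norm_sq] at h2
    have h3 : A (z m + w) (z m) ≤ ‖A (z m + w)‖ * M :=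
      (le_abs_self _).trans ((A (z m + w)).le_opNorm_of_le (hM m))
    have h4 := mul_le_mul_of_nonneg_left (z m).integral_potential_le hκ0
    have h5 := real_inner_comm w (z m)
    nlinarith [sq_nonneg ‖z m‖]
  have hsq : Tendsto (fun m => 1 / 2 * ‖z m‖ ^ 2) atTop (𝓝 0) :=
    tendsto_of_tendsto_of_tendsto_of_le_of_le tendsto_const_nhds hsum
      (fun m => by positivity) key
  have hsqrt := (hsq.const_mul 2).sqrt
  rw [tendsto_zero_iff_norm_tendsto_zero]
  refine (hsqrt.congr fun m => ?_).trans (by simp)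
  rw [← mul_assoc, mul_one_div_cancel two_ne_zero, one_mul, Real.sqrt_sq (norm_nonneg _)]

theorem palaisSmale_penalizedEnergy (hs : 0 < s) (hn : 2 * s < (n : ℝ)) (hp : 2 < p)
    (hp' : p < 2 * (n : ℝ) / ((n : ℝ) - 2 * s)) (hθ : 2 < θ) (hf : IsNonlinearity p θ f) :
    PalaisSmale (penalizedEnergy θ R f hK hV) := by
  have hmp : ∀ u : EnergySpace hK hV, MemLp u (ENNReal.ofReal p) volume :=
    memLp_of_le hs hn hp.le hp'.le
  obtain ⟨A, -, hd, hA⟩ := exists_continuous_hasFDerivAt_penalizedEnergy (R := R) hf hp hθ hmp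
  rintro u ⟨C, hC⟩ hu
  simp only [(hd _).fderiv] at hu
  have hθ0 : 0 < θ := by linarith
  have hκ : 0 < (θ - 2) / (4 * θ) := div_pos (by linarith) (by linarith)
  obtain ⟨C₁, hC₁⟩ := hu.norm.bddAbove_range
  have hC₁' : ∀ m, ‖A (u m)‖ ≤ C₁ := fun m => hC₁ ⟨m, rfl⟩
  have hC₁0 : 0 ≤ C₁ := (norm_nonneg (A (u 0))).trans (hC₁' 0)
  have hC0 : 0 ≤ C := (abs_nonneg _).trans (hC 0)
  -- From κ‖u‖² ≤ C + C₁‖u‖/θ. If ‖u‖ > 1, then C ≤ C‖u‖ and a factor ‖u‖ cancels; the added 1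
  -- covers ‖u‖ ≤ 1.
  have hM : ∀ m, ‖u m‖ ≤ (C + 1 / θ * C₁) / ((θ - 2) / (4 * θ)) + 1 := fun m => by
    have h1 := norm_sq_le_penalizedEnergy_sub (R := R) hf hp hθ hmp (u m)
    rw [← hA] at h1
    have h2 : -(A (u m) (u m)) ≤ C₁ * ‖u m‖ :=
      (neg_le_abs _).trans (((A (u m)).le_opNorm _).trans
        (mul_le_mul_of_nonneg_right (hC₁' m) (norm_nonneg _)))
    have h3 := (le_abs_self _).trans (hC m)
    have h4 := mul_le_mul_of_nonneg_left h2 (by positivity : 0 ≤ 1 / θ)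
    rcases le_or_gt ‖u m‖ 1 with h | h
    · have : 0 ≤ (C + 1 / θ * C₁) / ((θ - 2) / (4 * θ)) := by positivity
      linarith
    · have h5 : (θ - 2) / (4 * θ) * ‖u m‖ * ‖u m‖ ≤ (C + 1 / θ * C₁) * ‖u m‖ := by
        nlinarith
      have h6 := le_of_mul_le_mul_right h5 (by linarith)
      have h7 : ‖u m‖ ≤ (C + 1 / θ * C₁) / ((θ - 2) / (4 * θ)) := by
        rw [le_div_iff₀ hκ]; linarith
      linarith
  obtain ⟨w, φ, hφ, hw⟩ := exists_weakly_convergent_subseq hM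
  have hM' : ∀ m, ‖u (φ m) - w‖ ≤ (C + 1 / θ * C₁) / ((θ - 2) / (4 * θ)) + 1 + ‖w‖ := fun m =>
    (norm_sub_le _ _).trans (add_le_add (hM _) le_rfl)
  have hw' : ∀ v, Tendsto (fun m => inner ℝ (u (φ m) - w) v) atTop (𝓝 0) := fun v => by
    simpa [inner_sub_left] using (hw v).sub_const (inner ℝ w v)
  obtain ⟨ψ, hψ, hae⟩ := exists_subseq_ae_tendsto_zero hs hM' hw'
  refine ⟨w, φ ∘ ψ, hφ.comp hψ, ?_⟩
  have := tendsto_zero_of_ae_tendsto_zero hs hn hp hp' hθ hf hA w (fun m => hM' (ψ m)) hae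
    ((hw' w).comp hψ.tendsto_atTop) (by
      simpa [Function.comp_def] using hu.norm.comp (hφ.comp hψ).tendsto_atTop)
  simpa [Function.comp_def] using this.add_const w

end

end NonlocalSchrodinger

end

theorem proposition3p7 {n : ℕ} {s p θ R : ℝ}
    (hs0 : 0 < s) (hs1 : s < 1) (hn : 2 * s < (n : ℝ))
    (hp : 2 < p) (hp' : p < 2 * (n : ℝ) / ((n : ℝ) - 2 * s))
    (hθ : 2 < θ) (hR : 0 < R)
    {K V : EuclideanSpace ℝ (Fin n) → ℝ} {f : ℝ → ℝ}
    (hK : NonlocalSchrodinger.IsKernel s K)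
    (hV : NonlocalSchrodinger.IsPotential V)
    (hf : NonlocalSchrodinger.IsNonlinearity p θ f) :
    (∀ u : NonlocalSchrodinger.EnergySpace hK hV,
      Integrable (fun x => NonlocalSchrodinger.primitive
        (NonlocalSchrodinger.penalized θ R f V x) (u x)) volume) ∧
    ContDiff ℝ 1 (NonlocalSchrodinger.penalizedEnergy θ R f hK hV) ∧
    NonlocalSchrodinger.PalaisSmale (NonlocalSchrodinger.penalizedEnergy θ R f hK hV) := by
  have hmp : ∀ u : NonlocalSchrodinger.EnergySpace hK hV, MemLp u (ENNReal.ofReal p) volume :=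
    NonlocalSchrodinger.EnergySpace.memLp_of_le hs0 hn hp.le hp'.le
  obtain ⟨A, hA, hd, -⟩ := NonlocalSchrodinger.exists_continuous_hasFDerivAt_penalizedEnergy
    (R := R) hf hp hθ hmp
  exact ⟨fun u => NonlocalSchrodinger.EnergySpace.integrable_primitive_penalized hf hp hθ (hmp u),
    contDiff_one_iff_hasFDerivAt.2 ⟨A, hA, hd⟩,
    NonlocalSchrodinger.palaisSmale_penalizedEnergy hs0 hn hp hp' hθ hf⟩
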